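/- Let $p$ be a prime number. Let $F$ be a non-archimedean local field of residue characteristic $p$ (of characteristic $0$ or $p$), with ring of integers $O_F$ and uniformizer $p_F$. Let $L$ be a finite extension of $\mathbf{Q}_p$ with ring of integers $o$. Put $G=GL(2,F)$ and $K=GL(2,O_F)$, let $Z$ be the centre of $G$, $B$ the upper triangular subgroup, $B_0=B(O_F)$, $U$ the group of upper triangular unipotent matrices, $U_0=U(O_F)$, $t=\begin{pmatrix}p_F&0\\0&1\end{pmatrix}$, and let $B^+=B_0Zt^{\mathbf{N}}\subset B$. Let $V$ be a smooth representation of $G$ on a torsion $o$-module. Suppose that $V$ is admissible (that is, $V^H$ is a finitely generated $o$-module for every compact open subgroup $H$ of $G$) and finitely presented (that is, there is a finitely generated subrepresentation $W\subset V|_{KZ}$ such that the natural map $\mathrm{ind}_{KZ}^G W\to V$ from the compact induction is surjective with kernel a finitely generated representation of $G$). 1. For every $B^+$-stable $o$-submodule $M\subset V$ that is finitely generated as a representation of $B^+$, the set $M^{U_0}$ is finite. 2. Suppose moreover that $F$ has characteristic $0$. Let $V_0\subset V|_{B_0Z}$ be a finitely generated subrepresentation that generates $V$ as a representation of $B$.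 Write $\langle XV_0\rangle$ for the $o$-submodule spanned by the $xv$ with $x\in X$, $v\in V_0$, and put $$\Delta_V(V_0)=\langle B^+V_0\rangle\cap\langle (B-B^+)V_0\rangle,\qquad D_V(V_0)=\langle B^+V_0\rangle/\Delta_V(V_0).$$ Then the Pontryagin dual $D_V(V_0)^*=\mathrm{Hom}_o(D_V(V_0),L/o)$, with the contragredient action of $U_0$, is a finitely generated module over the completed group algebra $\Lambda_o(U_0)=o[[U_0]]$. -/

import Mathlib

set_option linter.unusedSectionVars false

noncomputable section

namespace GL2Rep

/-! ### Smooth representations of topological groups -/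

section General

variable {o G V : Type*} [CommRing o] [Group G] [AddCommGroup V] [Module o V]

/-- Every vector is fixed by an open subgroup. -/
def IsSmooth [TopologicalSpace G] (ρ : Representation o G V) : Prop :=
  ∀ v : V, ∃ H : OpenSubgroup G, ∀ h ∈ H, ρ h v = v

/-- The vectors fixed by any compact open subgroup `H` form a finitely generated `o`-module. -/
def IsAdmissible [TopologicalSpace G] (ρ : Representation o G V) : Prop :=
  ∀ H : Subgroup G, IsOpen (H : Set G) → IsCompact (H : Set G) →
    (Representation.invariants (MonoidHom.comp ρ H.subtype)).FG

/-- `⟨S X⟩`: the `o`-submodule spanned by the vectors `s x`, for `s ∈ S` and `x ∈ X`. -/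
def orbitSpan (ρ : Representation o G V) (S : Set G) (X : Set V) : Submodule o V :=
  Submodule.span o (Set.image2 (fun s x => ρ s x) S X)

/-- `M` is stable under `S`. -/
def IsStable (ρ : Representation o G V) (S : Set G) (M : Submodule o V) : Prop :=
  ∀ s ∈ S, ∀ m ∈ M, ρ s m ∈ M

/-- `M` is stable under `S` and generated by finitely many of its elements under the action of `S`
(used for `S` a subgroup or a submonoid). -/
def IsFGUnder (ρ : Representation o G V) (S : Set G) (M : Submodule o V) : Prop :=
  IsStable ρ S M ∧ ∃ X : Finset V, (X : Set V) ⊆ M ∧ M = orbitSpan ρ S X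

theorem isStable_orbitSpan (ρ : Representation o G V) (H : Subgroup G) (S : Set G) (X : Set V)
    (hS : ∀ h ∈ H, ∀ s ∈ S, h * s ∈ S) : IsStable ρ H (orbitSpan ρ S X) := by
  intro h hh m hm
  have key : orbitSpan ρ S X ≤ (orbitSpan ρ S X).comap (ρ h) := by
    refine Submodule.span_le.2 ?_
    rintro _ ⟨s, hs, x, hx, rfl⟩
    refine Submodule.subset_span ⟨h * s, hS h hh s hs, x, hx, ?_⟩
    simp
  exact key hm

/-- The representation of a subgroup `H` on an `H`-stable submodule `V₀` of `V`. -/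
def subRep (ρ : Representation o G V) (H : Subgroup G) (V₀ : Submodule o V)
    (h₀ : IsStable ρ H V₀) : Representation o H V₀ :=
  Representation.subrepresentation (MonoidHom.comp ρ H.subtype) V₀ fun h v hv => h₀ h h.2 v hv

/-- The natural map `ind_H^G V₀ → V`, sending `[g, v]` to `g⁻¹ v`; here `ind_H^G` is the left
adjoint of restriction to `H`, that is, compact induction when `H` is open and `V₀` smooth, and the
class `[g, v]` (with `[h g, h v] = [g, v]` for `h ∈ H`) is the function supported on `H g` with
value `v` at `g`. -/
def presentationMap (ρ : Representation o G V) (H : Subgroup G) (V₀ : Submodule o V)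
    (h₀ : IsStable ρ H V₀) :
    Representation.IndV H.subtype (subRep ρ H V₀ h₀) →ₗ[o] V :=
  Representation.Coinvariants.lift _
    (TensorProduct.lift
      ((Finsupp.lsum o (fun g : G =>
          LinearMap.toSpanSingleton o (V₀ →ₗ[o] V) (ρ g⁻¹ ∘ₗ V₀.subtype))) ∘ₗ
        (MonoidAlgebra.coeffLinearEquiv o).toLinearMap))
    (by
      intro h
      ext g v
      have e : ((subRep ρ H V₀ h₀ h v : V₀) : V) = ρ h v := rfl
      simp [e])

theorem presentationMap_mk (ρ : Representation o G V) (H : Subgroup G) (V₀ : Submodule o V)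
    (h₀ : IsStable ρ H V₀) (g : G) (v : V₀) :
    presentationMap ρ H V₀ h₀ (Representation.IndV.mk H.subtype _ g v) = ρ g⁻¹ v := by
  simp [presentationMap]

/-- `V` has a finite presentation relative to `H`: there is `V₀ ⊆ V|_H` finitely generated over
`H` such that the natural map `ind_H^G V₀ → V` is surjective, with a kernel that is finitely
generated as a representation of `G`. -/
def IsFinitelyPresented (ρ : Representation o G V) (H : Subgroup G) : Prop :=
  ∃ (V₀ : Submodule o V) (h₀ : IsStable ρ H V₀),
    IsFGUnder ρ H V₀ ∧
    Function.Surjective (presentationMap ρ H V₀ h₀) ∧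
    IsFGUnder (Representation.ind H.subtype (subRep ρ H V₀ h₀)) Set.univ
      (LinearMap.ker (presentationMap ρ H V₀ h₀))

end General

/-! ### The completed group algebra and the Pontryagin dual -/

section Iwasawa

variable (o H : Type*) [CommRing o] [Group H] [TopologicalSpace H]

/-- The completed group algebra `o[[H]] = lim o[H/N]`, over the open normal subgroups `N` of `H`,
as the algebra of compatible families. -/
def iwasawaAlgebra :
    Subalgebra o (∀ N : OpenNormalSubgroup H, MonoidAlgebra o (H ⧸ N.toSubgroup)) where
  carrier := {a | ∀ (N N' : OpenNormalSubgroup H) (h : N.toSubgroup ≤ N'.toSubgroup),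
    MonoidAlgebra.mapDomainAlgHom o o
      (QuotientGroup.map N.toSubgroup N'.toSubgroup (MonoidHom.id H) h) (a N) = a N'}
  mul_mem' := by
    intro a b ha hb N N' h
    rw [Pi.mul_apply, Pi.mul_apply, map_mul, ha N N' h, hb N N' h]
  add_mem' := by
    intro a b ha hb N N' h
    rw [Pi.add_apply, Pi.add_apply, map_add, ha N N' h, hb N N' h]
  algebraMap_mem' := by
    intro r N N' h
    rw [Pi.algebraMap_apply, Pi.algebraMap_apply, AlgHom.commutes]

variable {o H}
variable {W Q : Type*} [AddCommGroup W] [Module o W] [AddCommGroup Q] [Module o Q]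

/-- `∑_{c ∈ H/N} y(c) f(c⁻¹ w)`; independent of the representatives when `N` fixes `w`. -/
def evalSum (σ : Representation o H W) (f : W →ₗ[o] Q) (w : W) (N : OpenNormalSubgroup H)
    (y : MonoidAlgebra o (H ⧸ N.toSubgroup)) : Q :=
  y.coeff.sum fun c a => a • f (σ (Quotient.out c)⁻¹ w)

/-- The contragredient action `(h f)(w) = f(h⁻¹ w)`, extended to the group algebra. -/
def dualAct (σ : Representation o H W) : MonoidAlgebra o H →ₐ[o] Module.End o (W →ₗ[o] Q) :=
  (Representation.linHom σ (Representation.trivial o H Q)).asAlgebraHom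

theorem dualAct_single (σ : Representation o H W) (h : H) (a : o) (f : W →ₗ[o] Q) (w : W) :
    dualAct σ (MonoidAlgebra.single h a) f w = a • f (σ h⁻¹ w) := by
  simp [dualAct, Representation.asAlgebraHom_single]

/-- The projection `o[H] → o[H/N]`. -/
def toQuot (N : OpenNormalSubgroup H) :
    MonoidAlgebra o H →ₐ[o] MonoidAlgebra o (H ⧸ N.toSubgroup) :=
  MonoidAlgebra.mapDomainAlgHom o o (QuotientGroup.mk' N.toSubgroup)

theorem toQuot_single (N : OpenNormalSubgroup H) (h : H) (a : o) :
    toQuot N (MonoidAlgebra.single h a) =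
      MonoidAlgebra.single (QuotientGroup.mk' N.toSubgroup h) a := by
  simp [toQuot, MonoidAlgebra.mapDomainAlgHom]

theorem toQuot_surjective (N : OpenNormalSubgroup H) :
    Function.Surjective (toQuot (o := o) N) := by
  intro y
  induction y using MonoidAlgebra.induction_linear with
  | zero => exact ⟨0, map_zero _⟩
  | add x y hx hy =>
    obtain ⟨a, rfl⟩ := hx
    obtain ⟨b, rfl⟩ := hy
    exact ⟨a + b, map_add _ _ _⟩
  | single c r =>
    obtain ⟨h, rfl⟩ := QuotientGroup.mk'_surjective N.toSubgroup c
    exact ⟨MonoidAlgebra.single h r, toQuot_single N h r⟩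

theorem evalSum_toQuot (σ : Representation o H W) (f : W →ₗ[o] Q) (w : W)
    (N : OpenNormalSubgroup H) (hN : ∀ h ∈ N, σ h w = w) (x : MonoidAlgebra o H) :
    evalSum σ f w N (toQuot N x) = dualAct σ x f w := by
  induction x using MonoidAlgebra.induction_linear with
  | zero => simp [evalSum]
  | add x y hx hy =>
    rw [map_add, map_add, LinearMap.add_apply, LinearMap.add_apply, ← hx, ← hy]
    unfold evalSum
    rw [MonoidAlgebra.coeff_add, Finsupp.sum_add_index']
    · simp
    · intro c a b
      exact add_smul _ _ _
  | single h a =>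
    rw [toQuot_single, dualAct_single]
    unfold evalSum
    rw [MonoidAlgebra.coeff_single, Finsupp.sum_single_index (by simp)]
    congr 2
    obtain ⟨n, hn⟩ := QuotientGroup.mk_out_eq_mul N.toSubgroup h
    have e : (Quotient.out ((QuotientGroup.mk' N.toSubgroup) h))⁻¹ = (n : H)⁻¹ * h⁻¹ := by
      rw [← mul_inv_rev]
      exact congrArg _ hn
    rw [e]
    have e2 : (n : H)⁻¹ * h⁻¹ = h⁻¹ * (h * (n : H)⁻¹ * h⁻¹) := by group
    rw [e2, map_mul, Module.End.mul_apply]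
    congr 1
    exact hN _ (N.isNormal'.conj_mem _ (inv_mem n.2) h)

theorem toQuot_compat (a : iwasawaAlgebra o H) (N N' : OpenNormalSubgroup H)
    (h : N.toSubgroup ≤ N'.toSubgroup) (x : MonoidAlgebra o H)
    (hx : toQuot N x = a.1 N) : toQuot N' x = a.1 N' := by
  rw [← a.2 N N' h, ← hx]
  unfold toQuot
  rw [← AlgHom.comp_apply, ← MonoidAlgebra.mapDomainAlgHom_comp]
  rfl

theorem dualAct_congr (σ : Representation o H W) (N : OpenNormalSubgroup H) (f g : W →ₗ[o] Q)
    (hfg : ∀ w, (∀ h ∈ N, σ h w = w) → f w = g w) (x : MonoidAlgebra o H) (w : W)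
    (hw : ∀ h ∈ N, σ h w = w) : dualAct σ x f w = dualAct σ x g w := by
  induction x using MonoidAlgebra.induction_linear with
  | zero => simp
  | add x y hx hy => simp [hx, hy]
  | single k a =>
    rw [dualAct_single, dualAct_single, hfg]
    intro h hh
    have e : h * k⁻¹ = k⁻¹ * (k * h * k⁻¹) := by group
    rw [← Module.End.mul_apply, ← map_mul, e, map_mul, Module.End.mul_apply,
      hw _ (N.isNormal'.conj_mem _ hh k)]

/-- Every vector is fixed by an open normal subgroup; for a profinite group this is smoothness. -/
def IsNormallySmooth (σ : Representation o H W) : Prop :=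
  ∀ w : W, ∃ N : OpenNormalSubgroup H, ∀ h ∈ N, σ h w = w

/-- `Hom_o(W, Q)`, for a smooth representation `W` of `H`, viewed as a module over `o[[H]]`. -/
def SmoothDual (Q : Type*) [AddCommGroup Q] [Module o Q] (σ : Representation o H W)
    (_ : IsNormallySmooth σ) : Type _ :=
  W →ₗ[o] Q

namespace SmoothDual

variable {σ : Representation o H W} {hσ : IsNormallySmooth σ}

instance : AddCommGroup (SmoothDual Q σ hσ) :=
  inferInstanceAs (AddCommGroup (W →ₗ[o] Q))

theorem eval_eq (a : iwasawaAlgebra o H) (f : W →ₗ[o] Q) (w : W)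
    (N N' : OpenNormalSubgroup H) (hN : ∀ h ∈ N, σ h w = w) (hN' : ∀ h ∈ N', σ h w = w)
    (x : MonoidAlgebra o H) (hx : toQuot N x = a.1 N) :
    evalSum σ f w N' (a.1 N') = dualAct σ x f w := by
  obtain ⟨y, hy⟩ := toQuot_surjective (N ⊓ N') (a.1 (N ⊓ N'))
  rw [← toQuot_compat a (N ⊓ N') N' (fun _ h => h.2) y hy, evalSum_toQuot σ f w N' hN',
    ← evalSum_toQuot σ f w N hN, ← evalSum_toQuot σ f w N hN, hx,
    toQuot_compat a (N ⊓ N') N (fun _ h => h.1) y hy]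

/-- The action of `a ∈ o[[H]]` on `f : W → Q`: `(a f)(w) = ∑_{c ∈ H/N} a_N(c) f(c⁻¹ w)` for any
open normal subgroup `N` fixing `w`. -/
def act (hσ : IsNormallySmooth σ) (a : iwasawaAlgebra o H) (f : W →ₗ[o] Q) : W →ₗ[o] Q where
  toFun w := evalSum σ f w (hσ w).choose (a.1 (hσ w).choose)
  map_add' v w := by
    obtain ⟨y, hy⟩ := toQuot_surjective ((hσ v).choose ⊓ (hσ w).choose)
      (a.1 ((hσ v).choose ⊓ (hσ w).choose))
    have hv : ∀ h ∈ (hσ v).choose ⊓ (hσ w).choose, σ h v = v :=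
      fun h hh => (hσ v).choose_spec h hh.1
    have hw : ∀ h ∈ (hσ v).choose ⊓ (hσ w).choose, σ h w = w :=
      fun h hh => (hσ w).choose_spec h hh.2
    rw [eval_eq a f v _ _ hv (hσ v).choose_spec y hy,
      eval_eq a f w _ _ hw (hσ w).choose_spec y hy,
      eval_eq a f (v + w) _ _ (fun h hh => by rw [map_add, hv h hh, hw h hh])
        (hσ (v + w)).choose_spec y hy, map_add]
  map_smul' r w := by
    obtain ⟨y, hy⟩ := toQuot_surjective (hσ w).choose (a.1 (hσ w).choose)
    rw [eval_eq a f w _ _ (hσ w).choose_spec (hσ w).choose_spec y hy,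
      eval_eq a f (r • w) _ _ (fun h hh => by rw [map_smul, (hσ w).choose_spec h hh])
        (hσ (r • w)).choose_spec y hy, map_smul, RingHom.id_apply]

theorem act_eq (a : iwasawaAlgebra o H) (f : W →ₗ[o] Q) (w : W)
    (N : OpenNormalSubgroup H) (hN : ∀ h ∈ N, σ h w = w) (x : MonoidAlgebra o H)
    (hx : toQuot N x = a.1 N) : act hσ a f w = dualAct σ x f w :=
  eval_eq a f w N _ hN (hσ w).choose_spec x hx

theorem act_apply (a : iwasawaAlgebra o H) (f : W →ₗ[o] Q) (w : W)
    (N : OpenNormalSubgroup H) (hN : ∀ h ∈ N, σ h w = w) :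
    act hσ a f w = evalSum σ f w N (a.1 N) := by
  obtain ⟨x, hx⟩ := toQuot_surjective N (a.1 N)
  rw [act_eq a f w N hN x hx, ← hx, evalSum_toQuot σ f w N hN]

instance : Module (iwasawaAlgebra o H) (SmoothDual Q σ hσ) where
  smul a f := act hσ a f
  one_smul f := by
    refine LinearMap.ext fun w => ?_
    obtain ⟨N, hN⟩ := hσ w
    refine (act_eq 1 f w N hN 1 (map_one _)).trans ?_
    rw [map_one]
    rfl
  mul_smul a b f := by
    refine LinearMap.ext fun w => ?_
    obtain ⟨N, hN⟩ := hσ w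
    obtain ⟨x, hx⟩ := toQuot_surjective N (a.1 N)
    obtain ⟨y, hy⟩ := toQuot_surjective N (b.1 N)
    refine (act_eq (a * b) f w N hN (x * y) ?_).trans ?_
    · rw [map_mul, hx, hy]
      rfl
    · refine Eq.trans ?_ (act_eq a (act hσ b f) w N hN x hx).symm
      refine (DFunLike.congr_fun (DFunLike.congr_fun (map_mul (dualAct σ) x y) f) w).trans ?_
      exact dualAct_congr σ N _ _ (fun v hv => (act_eq b f v N hv y hy).symm) x w hN
  smul_zero a := by
    refine LinearMap.ext fun w => ?_
    obtain ⟨N, hN⟩ := hσ w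
    obtain ⟨x, hx⟩ := toQuot_surjective N (a.1 N)
    refine (act_eq a 0 w N hN x hx).trans ?_
    rw [map_zero]
    rfl
  smul_add a f g := by
    refine LinearMap.ext fun w => ?_
    obtain ⟨N, hN⟩ := hσ w
    obtain ⟨x, hx⟩ := toQuot_surjective N (a.1 N)
    refine (act_eq a (f + g : W →ₗ[o] Q) w N hN x hx).trans ?_
    refine (DFunLike.congr_fun (map_add (dualAct σ x) (f : W →ₗ[o] Q) g) w).trans ?_
    exact (congrArg₂ (· + ·) (act_eq a f w N hN x hx) (act_eq a g w N hN x hx)).symm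
  add_smul a b f := by
    refine LinearMap.ext fun w => ?_
    obtain ⟨N, hN⟩ := hσ w
    obtain ⟨x, hx⟩ := toQuot_surjective N (a.1 N)
    obtain ⟨y, hy⟩ := toQuot_surjective N (b.1 N)
    refine (act_eq (a + b) f w N hN (x + y) ?_).trans ?_
    · rw [map_add, hx, hy]
      rfl
    · rw [map_add]
      exact (congrArg₂ (· + ·) (act_eq a f w N hN x hx) (act_eq b f w N hN y hy)).symm
  zero_smul f := by
    refine LinearMap.ext fun w => ?_
    obtain ⟨N, hN⟩ := hσ w
    refine (act_eq 0 f w N hN 0 (map_zero _)).trans ?_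
    rw [map_zero]
    rfl

end SmoothDual

end Iwasawa

/-! ### Subgroups of `GL(2, F)` -/

section Groups

variable (F : Type*) [Field F] [ValuativeRel F] [TopologicalSpace F] [IsNonarchimedeanLocalField F]

/-- The ring of integers `O_F`. -/
abbrev IntegerRing : Subring F := (ValuativeRel.valuation F).integer

/-- `K = GL(2, O_F)`, as a subgroup of `GL(2, F)`. -/
def maxCompact : Subgroup (GL (Fin 2) F) :=
  (Matrix.GeneralLinearGroup.map (n := Fin 2) (algebraMap (IntegerRing F) F)).range

/-- The centre `Z` of `GL(2, F)`. -/
abbrev centre : Subgroup (GL (Fin 2) F) := Subgroup.center (GL (Fin 2) F)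

/-- The upper triangular subgroup `B`. -/
def borel : Subgroup (GL (Fin 2) F) where
  carrier := {g | g.1 1 0 = 0}
  mul_mem' := by
    intro a b ha hb
    simp only [Set.mem_ofPred_eq] at ha hb
    simp [Matrix.mul_apply, Fin.sum_univ_two, ha, hb]
  one_mem' := by simp
  inv_mem' := by
    intro a ha
    simp only [Set.mem_ofPred_eq] at ha
    simp [Matrix.inv_def, Matrix.adjugate_fin_two, ha]

/-- The unipotent radical `U` of `B`. -/
def unipotent : Subgroup (GL (Fin 2) F) where
  carrier := {g | g.1 1 0 = 0 ∧ g.1 0 0 = 1 ∧ g.1 1 1 = 1}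
  mul_mem' := by
    rintro a b ⟨ha, ha', ha''⟩ ⟨hb, hb', hb''⟩
    simp [Matrix.mul_apply, Fin.sum_univ_two, ha, ha', ha'', hb, hb', hb'']
  one_mem' := by simp
  inv_mem' := by
    rintro a ⟨ha, ha', ha''⟩
    simp [Matrix.inv_def, Matrix.adjugate_fin_two, Matrix.det_fin_two, ha, ha', ha'']

/-- `B₀ = B(O_F)`. -/
def borelInt : Subgroup (GL (Fin 2) F) := borel F ⊓ maxCompact F

/-- `U₀ = U(O_F)`. -/
def unipotentInt : Subgroup (GL (Fin 2) F) := unipotent F ⊓ maxCompact F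

variable {F}

/-- The matrix `t = diag(p_F, 1)`. -/
def tElt (ϖ : IntegerRing F) (hϖ : Irreducible ϖ) : GL (Fin 2) F :=
  Matrix.GeneralLinearGroup.mkOfDetNeZero !![(ϖ : F), 0; 0, 1] (by
    have h : (ϖ : F) ≠ 0 := fun h => hϖ.ne_zero (Subtype.ext h)
    simpa [Matrix.det_fin_two] using h)

/-- The monoid `B⁺ = B₀ Z t^ℕ`, as a subset of `GL(2, F)`. -/
def borelPlus (ϖ : IntegerRing F) (hϖ : Irreducible ϖ) : Set (GL (Fin 2) F) :=
  {g | ∃ b ∈ borelInt F, ∃ z ∈ centre F, ∃ n : ℕ, g = b * z * tElt ϖ hϖ ^ n}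

theorem unipotentInt_le_borelInt : unipotentInt F ≤ borelInt F :=
  fun _ h => ⟨h.1.1, h.2⟩

theorem mul_mem_borelPlus (ϖ : IntegerRing F) (hϖ : Irreducible ϖ) {u g : GL (Fin 2) F}
    (hu : u ∈ unipotentInt F) (hg : g ∈ borelPlus ϖ hϖ) : u * g ∈ borelPlus ϖ hϖ := by
  obtain ⟨b, hb, z, hz, n, rfl⟩ := hg
  exact ⟨u * b, mul_mem (unipotentInt_le_borelInt hu) hb, z, hz, n, by simp [mul_assoc]⟩

theorem mul_mem_borel_diff (ϖ : IntegerRing F) (hϖ : Irreducible ϖ) {u g : GL (Fin 2) F}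
    (hu : u ∈ unipotentInt F) (hg : g ∈ (borel F : Set (GL (Fin 2) F)) \ borelPlus ϖ hϖ) :
    u * g ∈ (borel F : Set (GL (Fin 2) F)) \ borelPlus ϖ hϖ := by
  refine ⟨mul_mem (unipotentInt_le_borelInt hu).1 hg.1, fun h => hg.2 ?_⟩
  have := mul_mem_borelPlus ϖ hϖ (inv_mem hu) h
  rwa [inv_mul_cancel_left] at this

theorem unipotentInt_comm (a b : unipotentInt F) : a * b = b * a := by
  obtain ⟨a, ⟨ha, ha', ha''⟩, -⟩ := a
  obtain ⟨b, ⟨hb, hb', hb''⟩, -⟩ := b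
  refine Subtype.ext (Units.ext ?_)
  ext i j
  fin_cases i <;> fin_cases j <;>
    simp [Matrix.mul_apply, Fin.sum_univ_two, ha, ha', ha'', hb, hb', hb'', add_comm]

end Groups

/-! ### The module `D_V(V₀)` and its dual -/

section DV

variable {F : Type*} [Field F] [ValuativeRel F] [TopologicalSpace F] [IsNonarchimedeanLocalField F]
variable {o V : Type*} [CommRing o] [AddCommGroup V] [Module o V]
variable (ρ : Representation o (GL (Fin 2) F) V) (ϖ : IntegerRing F) (hϖ : Irreducible ϖ)
  (V₀ : Submodule o V)

/-- `⟨B⁺ V₀⟩`. -/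
def plusPart : Submodule o V := orbitSpan ρ (borelPlus ϖ hϖ) V₀

/-- `⟨(B - B⁺) V₀⟩`. -/
def minusPart : Submodule o V :=
  orbitSpan ρ ((borel F : Set (GL (Fin 2) F)) \ borelPlus ϖ hϖ) V₀

/-- `Δ_V(V₀) = ⟨B⁺ V₀⟩ ∩ ⟨(B - B⁺) V₀⟩`. -/
def deltaPart : Submodule o V := plusPart ρ ϖ hϖ V₀ ⊓ minusPart ρ ϖ hϖ V₀

/-- `D_V(V₀) = ⟨B⁺ V₀⟩ / Δ_V(V₀)`. -/
abbrev DV : Type _ :=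
  plusPart ρ ϖ hϖ V₀ ⧸ (deltaPart ρ ϖ hϖ V₀).submoduleOf (plusPart ρ ϖ hϖ V₀)

theorem plusPart_stable : IsStable ρ (unipotentInt F) (plusPart ρ ϖ hϖ V₀) :=
  isStable_orbitSpan ρ _ _ _ fun _ hu _ hg => mul_mem_borelPlus ϖ hϖ hu hg

theorem deltaPart_stable : IsStable ρ (unipotentInt F) (deltaPart ρ ϖ hϖ V₀) :=
  fun u hu m hm => ⟨plusPart_stable ρ ϖ hϖ V₀ u hu m hm.1,
    isStable_orbitSpan ρ _ _ _ (fun _ hu _ hg => mul_mem_borel_diff ϖ hϖ hu hg) u hu m hm.2⟩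

/-- The action of `U₀` on `D_V(V₀)`. -/
def DVRep : Representation o (unipotentInt F) (DV ρ ϖ hϖ V₀) :=
  (subRep ρ (unipotentInt F) (plusPart ρ ϖ hϖ V₀) (plusPart_stable ρ ϖ hϖ V₀)).quotient _
    fun u m hm => deltaPart_stable ρ ϖ hϖ V₀ u u.2 m hm

theorem DVRep_smooth (hρ : IsSmooth ρ) : IsNormallySmooth (DVRep ρ ϖ hϖ V₀) := by
  intro w
  obtain ⟨m, rfl⟩ := Submodule.Quotient.mk_surjective _ w
  obtain ⟨H, hH⟩ := hρ m
  refine ⟨⟨H.comap (unipotentInt F).subtype continuous_subtype_val, ⟨fun n hn g => ?_⟩⟩, ?_⟩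
  · rw [unipotentInt_comm g n, mul_inv_cancel_right]
    exact hn
  · intro h hh
    have : subRep ρ (unipotentInt F) (plusPart ρ ϖ hϖ V₀) (plusPart_stable ρ ϖ hϖ V₀) h m = m :=
      Subtype.ext (hH h hh)
    exact congrArg (Submodule.Quotient.mk) this

/-- The Pontryagin dual `D_V(V₀)^* = Hom_o(D_V(V₀), Q)`, a module over `Λ_o(U₀) = o[[U₀]]`; the
dualizing module `Q` is to be taken equal to `L/o`. -/
abbrev DVDual (Q : Type*) [AddCommGroup Q] [Module o Q] (hρ : IsSmooth ρ) : Type _ :=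
  SmoothDual Q (DVRep ρ ϖ hϖ V₀) (DVRep_smooth ρ ϖ hϖ V₀ hρ)

end DV

end GL2Rep

end

set_option linter.unusedSectionVars false

noncomputable section

namespace GL2Rep

open ValuativeRel Topology

/-! ### Compactness and openness in `GL(2, F)` -/

section Topology

variable {F : Type*} [Field F] [ValuativeRel F] [TopologicalSpace F] [IsNonarchimedeanLocalField F]

/-! Since `V` is torsion and `o` is finite free over `ℤ_[p]`, finitely generated `o`-submodules of
`V` are finite sets; admissibility then says that `V^H` is finite for `H` compact open. For `Y ⊆ V`
write `Δ(Y) = ⟨B⁺Y⟩ ∩ ⟨(B - B⁺)Y⟩`.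

Finite presentation makes `Δ(Y)` finite for finite `Y` (`finite_borelPlus_inf_diff`). Let `W` be the
finite `KZ`-representation of the presentation. Among the vertices `G/KZ` of the tree, `S = B⁺KZ` is
a half-tree (`halfTree`) and `S ∩ B = B⁺`. A vector of `⟨SW⟩ ∩ ⟨SᶜW⟩` is the truncation to `S` of a
relation, that is, of an element of the kernel of `ind W → V`. The kernel is generated by finitely
many relations of finite support, and a translate of one of them has a nonzero truncation only when
its support meets both `S` and `Sᶜ`. The boundary of a half-tree is finite
(`exists_finset_halfTree`), so only finitely many truncations occur. Replacing `W` by `Y` changes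
both spans by a finite amount.

For part 1, enlarge the generators `X` of `M` to `Y = X ∪ W`, which generates `V` over `B` by the
Iwasawa decomposition. An invariant `v ∈ ⟨B⁺Y⟩^{U₀}` lies in `⟨(B - B⁺)Y⟩`
(`mem_orbitSpan_diff_of_invariant`): Hecke operators of `tⁿ` at a suitable compact open level `J`
give `wₙ ∈ V^J` with `t⁻ⁿwₙ ≡ v`; as `V^J` is finite, some `w` equals `wₙ` for infinitely many `n`,
and `t⁻ⁿw` lies in `⟨(B - B⁺)Y⟩` for large `n`. Hence `M^{U₀} ⊆ Δ(Y)`.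

For part 2, `U₀` is topologically finitely generated in characteristic 0, so the finiteness of
`⟨B⁺V₀⟩^{U₀}` passes to the quotient `D` by the finite module `Δ(V₀)`
(`finite_invariants_quotient`). As `U₀` is pro-`p` and `D^{U₀}` is finite, a dual form of Nakayama's
lemma (`finite_smoothDual`) embeds `D` in finitely many copies of the smooth functions `U₀ → L/o`.
By injectivity of `L/o`, functionals on `D` extend to these functions, whose dual is `o[[U₀]]`. -/

theorem t2Space : T2Space F := by
  refine IsTopologicalAddGroup.t2Space_of_zero_sep fun x hx => ?_
  refine ⟨{y | valuation F y < valuation F x}, ?_, fun h => lt_irrefl (valuation F x) h⟩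
  exact (IsValuativeTopology.hasBasis_nhds_zero' F).mem_of_mem (by simpa using hx)

/-- The elements of `GL(2, F)` whose entries, and those of the inverse, are bounded by `γ`. -/
def boundedSet (F : Type*) [Field F] [ValuativeRel F] (γ : ValueGroupWithZero F) :
    Set (GL (Fin 2) F) :=
  {g | ∀ i j, valuation F (g.1 i j) ≤ γ ∧ valuation F (g⁻¹.1 i j) ≤ γ}

/-- Compactness is that of the closed set of pairs of bounded matrices inverse to each other;
recording the inverse as well makes this set map continuously to the group of units. -/
theorem isCompact_boundedSet (γ : ValueGroupWithZero F) : IsCompact (boundedSet F γ) := by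
  let C : Set (Matrix (Fin 2) (Fin 2) F) := {m | ∀ i j, valuation F (m i j) ≤ γ}
  have hC : IsCompact C := by
    have h := isCompact_univ_pi (fun _ : Fin 2 => isCompact_univ_pi
      (fun _ : Fin 2 => IsNonarchimedeanLocalField.isCompact_closedBall F γ))
    have e : C = (Set.univ.pi fun _ => Set.univ.pi fun _ => {x | valuation F x ≤ γ} :
        Set (Fin 2 → Fin 2 → F)) := by
      exact Set.ext fun m => ⟨fun h i _ j _ => h i j, fun h i j => h i trivial j trivial⟩
    exact e ▸ h
  let D : Set (Matrix (Fin 2) (Fin 2) F × Matrix (Fin 2) (Fin 2) F) :=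
    (C ×ˢ C) ∩ {p | p.1 * p.2 = 1 ∧ p.2 * p.1 = 1}
  have := t2Space (F := F)
  have hD : IsCompact D := by
    refine (hC.prod hC).inter_right ?_
    refine IsClosed.inter ?_ ?_
    · exact isClosed_eq (by fun_prop) continuous_const
    · exact isClosed_eq (by fun_prop) continuous_const
  have := isCompact_iff_compactSpace.1 hD
  let f : D → GL (Fin 2) F := fun p => ⟨p.1.1, p.1.2, p.2.2.1, p.2.2.2⟩
  have hf : Continuous f := by
    refine Units.continuous_iff.2 ⟨?_, ?_⟩
    · exact continuous_fst.comp continuous_subtype_val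
    · exact continuous_snd.comp continuous_subtype_val
  have : boundedSet F γ = Set.range f := by
    ext g
    constructor
    · intro hg
      exact ⟨⟨(g.1, g⁻¹.1), ⟨fun i j => (hg i j).1, fun i j => (hg i j).2⟩,
        g.mul_inv, g.inv_mul⟩, Units.ext rfl⟩
    · rintro ⟨p, rfl⟩ i j
      exact ⟨p.2.1.1 i j, p.2.1.2 i j⟩
  rw [this]
  exact isCompact_range hf

theorem isOpen_setOf_valuation_le {X : Type*} [TopologicalSpace X] {f : X → F}
    (hf : Continuous f) {γ : ValueGroupWithZero F} (hγ : γ ≠ 0) :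
    IsOpen {x | valuation F (f x) ≤ γ} := by
  have : IsOpen {x : F | valuation F x ≤ γ} := by
    obtain ⟨c, rfl⟩ := valuation_surjective γ
    simp_rw [← (valuation F).restrict_le_iff]
    refine Valuation.isOpen_closedBall ?_
    rw [ne_eq, map_eq_zero] at hγ ⊢
    exact hγ
  exact this.preimage hf

theorem continuous_entry (i j : Fin 2) : Continuous fun g : GL (Fin 2) F => g.1 i j :=
  Units.continuous_val.matrix_elem i j

theorem continuous_inv_entry (i j : Fin 2) : Continuous fun g : GL (Fin 2) F => g⁻¹.1 i j :=
  Units.continuous_coe_inv.matrix_elem i j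

theorem isOpen_boundedSet {γ : ValueGroupWithZero F} (hγ : γ ≠ 0) :
    IsOpen (boundedSet F γ) := by
  have : boundedSet F γ = ⋂ i : Fin 2, ⋂ j : Fin 2,
      ({g | valuation F (g.1 i j) ≤ γ} ∩ {g | valuation F (g⁻¹.1 i j) ≤ γ}) := by
    ext g
    simp [boundedSet]
  rw [this]
  exact isOpen_iInter_of_finite fun i => isOpen_iInter_of_finite fun j =>
    (isOpen_setOf_valuation_le (continuous_entry i j) hγ).inter
      (isOpen_setOf_valuation_le (continuous_inv_entry i j) hγ)

/-- Integrality of `g` and of `g⁻¹` characterizes `GL(2, O_F)`, so openness and compactness both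
follow from those of `boundedSet`. -/
theorem coe_maxCompact : (maxCompact F : Set (GL (Fin 2) F)) = boundedSet F 1 := by
  ext g
  constructor
  · rintro ⟨h, rfl⟩ i j
    refine ⟨?_, ?_⟩
    · exact (h.1 i j).2
    · rw [← map_inv]
      exact (h⁻¹.1 i j).2
  · intro hg
    let A : Matrix (Fin 2) (Fin 2) (IntegerRing F) := Matrix.of fun i j => ⟨g.1 i j, (hg i j).1⟩
    let B : Matrix (Fin 2) (Fin 2) (IntegerRing F) :=
      Matrix.of fun i j => ⟨g⁻¹.1 i j, (hg i j).2⟩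
    have hA : A.map (algebraMap (IntegerRing F) F) = g.1 := rfl
    have hB : B.map (algebraMap (IntegerRing F) F) = g⁻¹.1 := rfl
    have hinj := Matrix.map_injective (m := Fin 2) (n := Fin 2)
      (FaithfulSMul.algebraMap_injective (IntegerRing F) F)
    refine ⟨⟨A, B, hinj ?_, hinj ?_⟩, Units.ext rfl⟩
    · simp only [Matrix.map_mul, Matrix.map_one, map_zero, map_one, hA, hB]
      exact g.mul_inv
    · simp only [Matrix.map_mul, Matrix.map_one, map_zero, map_one, hA, hB]
      exact g.inv_mul

theorem isCompact_maxCompact : IsCompact (maxCompact F : Set (GL (Fin 2) F)) :=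
  coe_maxCompact (F := F) ▸ isCompact_boundedSet 1

theorem isOpen_maxCompact : IsOpen (maxCompact F : Set (GL (Fin 2) F)) :=
  coe_maxCompact (F := F) ▸ isOpen_boundedSet one_ne_zero

theorem inv_fin_two (g : GL (Fin 2) F) :
    (g⁻¹.1 : Matrix (Fin 2) (Fin 2) F) =
      g.1.det⁻¹ • !![g.1 1 1, - g.1 0 1; - g.1 1 0, g.1 0 0] := by
  rw [Matrix.coe_units_inv, Matrix.inv_def, Matrix.adjugate_fin_two, Ring.inverse_eq_inv']

theorem mem_maxCompact_iff {g : GL (Fin 2) F} :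
    g ∈ maxCompact F ↔ (∀ i j, valuation F (g.1 i j) ≤ 1) ∧ valuation F g.1.det = 1 := by
  rw [← SetLike.mem_coe, coe_maxCompact]
  have key : ∀ m : Matrix (Fin 2) (Fin 2) F, (∀ i j, valuation F (m i j) ≤ 1) →
      valuation F m.det ≤ 1 := by
    intro m hm
    rw [Matrix.det_fin_two]
    refine (Valuation.map_sub _ _ _).trans (max_le ?_ ?_) <;> rw [map_mul] <;>
      exact mul_le_one' (hm _ _) (hm _ _)
  constructor
  · intro hg
    refine ⟨fun i j => (hg i j).1, le_antisymm (key _ fun i j => (hg i j).1) ?_⟩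
    have h1 := key g⁻¹.1 fun i j => (hg i j).2
    have h2 : valuation F g.1.det * valuation F g⁻¹.1.det = 1 := by
      rw [← map_mul, ← Matrix.det_mul, g.mul_inv, Matrix.det_one, map_one]
    calc (1 : ValueGroupWithZero F) = valuation F g.1.det * valuation F g⁻¹.1.det := h2.symm
      _ ≤ valuation F g.1.det * 1 := mul_le_mul_right h1 _
      _ = _ := mul_one _
  · rintro ⟨h1, h2⟩ i j
    refine ⟨h1 i j, ?_⟩
    rw [inv_fin_two]
    fin_cases i <;> fin_cases j <;> simp [h2, h1]

end Topology

/-! ### The half-tree `B⁺KZ` and its finite boundary -/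

section GroupTheory

theorem exists_finset_cosets {G : Type*} [Group G] [TopologicalSpace G] [IsTopologicalGroup G]
    {A : Set G} (hA : IsCompact A) (K : Subgroup G) (hK : IsOpen (K : Set G)) :
    ∃ T : Finset G, ∀ a ∈ A, ∃ τ ∈ T, τ⁻¹ * a ∈ K := by
  obtain ⟨T, -, hT⟩ := hA.elim_nhds_subcover (fun τ => {a | τ⁻¹ * a ∈ K}) fun a _ => by
    refine IsOpen.mem_nhds (hK.preimage (continuous_const_mul a⁻¹)) ?_
    simp
  refine ⟨T, fun a ha => ?_⟩
  simpa using hT ha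

variable {F : Type*} [Field F] [ValuativeRel F] [TopologicalSpace F] [IsNonarchimedeanLocalField F]

theorem mem_centre_iff {g : GL (Fin 2) F} :
    g ∈ centre F ↔ g.1 0 1 = 0 ∧ g.1 1 0 = 0 ∧ g.1 0 0 = g.1 1 1 := by
  rw [Matrix.GeneralLinearGroup.mem_center_iff_val_mem_range_scalar]
  constructor
  · rintro ⟨a, ha⟩
    simp [← ha]
  · rintro ⟨h1, h2, h3⟩
    refine ⟨g.1 1 1, ?_⟩
    ext i j
    fin_cases i <;> fin_cases j <;> simp [h1, h2, h3]

/-- The scalar matrix `a`. -/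
def scalarElt (a : F) (ha : a ≠ 0) : GL (Fin 2) F :=
  Matrix.GeneralLinearGroup.mkOfDetNeZero !![a, 0; 0, a] (by simpa [Matrix.det_fin_two] using ha)

theorem coe_scalarElt (a : F) (ha : a ≠ 0) : (scalarElt a ha).1 = !![a, 0; 0, a] := rfl

theorem scalarElt_mem (a : F) (ha : a ≠ 0) : scalarElt a ha ∈ centre F := by
  rw [mem_centre_iff]
  simp [coe_scalarElt]

theorem mem_borel_iff {g : GL (Fin 2) F} : g ∈ borel F ↔ g.1 1 0 = 0 := Iff.rfl

theorem diag_ne_zero {g : GL (Fin 2) F} (hg : g.1 1 0 = 0) : g.1 0 0 ≠ 0 ∧ g.1 1 1 ≠ 0 := by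
  have h : g.1.det ≠ 0 := g.isUnit.map Matrix.detMonoidHom |>.ne_zero
  rw [Matrix.det_fin_two, hg, mul_zero, sub_zero] at h
  exact mul_ne_zero_iff.1 h

theorem mul_fin_two (g h : GL (Fin 2) F) (i j : Fin 2) :
    (g * h).1 i j = g.1 i 0 * h.1 0 j + g.1 i 1 * h.1 1 j := by
  rw [Units.val_mul, Matrix.mul_apply, Fin.sum_univ_two]

theorem valuation_add_mul_le {a b c d : F} {γ : ValueGroupWithZero F}
    (h1 : valuation F a * valuation F b ≤ γ) (h2 : valuation F c * valuation F d ≤ γ) :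
    valuation F (a * b + c * d) ≤ γ := by
  refine (Valuation.map_add _ _ _).trans (max_le ?_ ?_) <;> rwa [map_mul]

theorem mul_mem_boundedSet {γ δ : ValueGroupWithZero F} {g h : GL (Fin 2) F}
    (hg : g ∈ boundedSet F γ) (hh : h ∈ boundedSet F δ) : g * h ∈ boundedSet F (γ * δ) := by
  intro i j
  rw [mul_inv_rev, mul_fin_two, mul_fin_two]
  refine ⟨valuation_add_mul_le ?_ ?_, valuation_add_mul_le ?_ ?_⟩
  · exact mul_le_mul' (hg _ _).1 (hh _ _).1
  · exact mul_le_mul' (hg _ _).1 (hh _ _).1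
  · rw [mul_comm γ]
    exact mul_le_mul' (hh _ _).2 (hg _ _).2
  · rw [mul_comm γ]
    exact mul_le_mul' (hh _ _).2 (hg _ _).2

theorem exists_mem_boundedSet (g : GL (Fin 2) F) : ∃ γ, 1 ≤ γ ∧ g ∈ boundedSet F γ := by
  let γ : ValueGroupWithZero F := 1 ⊔ (Finset.univ.sup' Finset.univ_nonempty
    fun p : Fin 2 × Fin 2 => valuation F (g.1 p.1 p.2) ⊔ valuation F (g⁻¹.1 p.1 p.2))
  refine ⟨γ, le_sup_left, fun i j => ?_⟩
  have h := (Finset.le_sup' (fun p : Fin 2 × Fin 2 =>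
    valuation F (g.1 p.1 p.2) ⊔ valuation F (g⁻¹.1 p.1 p.2)) (Finset.mem_univ (i, j))).trans
      (le_sup_right : _ ≤ γ)
  exact ⟨le_sup_left.trans h, le_sup_right.trans h⟩

/-- The norm of the `i`-th row. -/
def rowNorm (i : Fin 2) (g : GL (Fin 2) F) : ValueGroupWithZero F :=
  valuation F (g.1 i 0) ⊔ valuation F (g.1 i 1)

theorem le_rowNorm (i j : Fin 2) (g : GL (Fin 2) F) : valuation F (g.1 i j) ≤ rowNorm i g := by
  fin_cases j
  · exact le_sup_left
  · exact le_sup_right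

theorem rowNorm_mul_le (i : Fin 2) (g : GL (Fin 2) F) {k : GL (Fin 2) F} (hk : k ∈ maxCompact F) :
    rowNorm i (g * k) ≤ rowNorm i g := by
  have hk := (mem_maxCompact_iff.1 hk).1
  refine sup_le ?_ ?_ <;> rw [mul_fin_two] <;> refine valuation_add_mul_le ?_ ?_ <;>
    exact mul_le_of_le_of_le_one (le_rowNorm _ _ _) (hk _ _)

theorem rowNorm_mul_maxCompact (i : Fin 2) (g : GL (Fin 2) F) {k : GL (Fin 2) F}
    (hk : k ∈ maxCompact F) : rowNorm i (g * k) = rowNorm i g := by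
  refine le_antisymm (rowNorm_mul_le i g hk) ?_
  have := rowNorm_mul_le i (g * k) (inv_mem hk)
  rwa [mul_inv_cancel_right] at this

theorem rowNorm_mul_centre (i : Fin 2) (g : GL (Fin 2) F) {z : GL (Fin 2) F}
    (hz : z ∈ centre F) : rowNorm i (g * z) = rowNorm i g * valuation F (z.1 1 1) := by
  obtain ⟨h1, h2, h3⟩ := mem_centre_iff.1 hz
  unfold rowNorm
  rw [mul_fin_two, mul_fin_two, h1, h2, h3, mul_zero, mul_zero, add_zero, zero_add, map_mul,
    map_mul]
  exact max_mul_mul_right _ _ (valuation F (z.1 1 1))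

/-- The set `B⁺KZ`, described by the condition that the first row is dominated by the second. -/
def halfTree (F : Type*) [Field F] [ValuativeRel F] : Set (GL (Fin 2) F) :=
  {g | rowNorm 0 g ≤ rowNorm 1 g}

theorem valuation_centre_pos {z : GL (Fin 2) F} (hz : z ∈ centre F) :
    0 < valuation F (z.1 1 1) := by
  rw [Valuation.pos_iff]
  exact (diag_ne_zero (mem_centre_iff.1 hz).2.1).2

theorem mul_centre_mem_halfTree_iff {g z : GL (Fin 2) F} (hz : z ∈ centre F) :
    g * z ∈ halfTree F ↔ g ∈ halfTree F := by
  change rowNorm 0 (g * z) ≤ rowNorm 1 (g * z) ↔ rowNorm 0 g ≤ rowNorm 1 g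
  rw [rowNorm_mul_centre _ _ hz, rowNorm_mul_centre _ _ hz,
    mul_le_mul_iff_left₀ (valuation_centre_pos hz)]

theorem mul_maxCompact_mem_halfTree_iff {g k : GL (Fin 2) F} (hk : k ∈ maxCompact F) :
    g * k ∈ halfTree F ↔ g ∈ halfTree F := by
  change rowNorm 0 (g * k) ≤ rowNorm 1 (g * k) ↔ rowNorm 0 g ≤ rowNorm 1 g
  rw [rowNorm_mul_maxCompact _ _ hk, rowNorm_mul_maxCompact _ _ hk]

theorem mem_sup_centre_iff {H : Subgroup (GL (Fin 2) F)} {g : GL (Fin 2) F} :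
    g ∈ H ⊔ centre F ↔ ∃ h ∈ H, ∃ z ∈ centre F, h * z = g :=
  Subgroup.mem_sup_of_normal_right

/-- Right multiplication by `K` preserves the norms of the rows and `Z` scales both by the same
factor, so `halfTree` is a set of vertices in `G/KZ`. -/
theorem mul_mem_halfTree_iff {g k : GL (Fin 2) F} (hk : k ∈ maxCompact F ⊔ centre F) :
    g * k ∈ halfTree F ↔ g ∈ halfTree F := by
  obtain ⟨k', hk', z, hz, rfl⟩ := mem_sup_centre_iff.1 hk
  rw [← mul_assoc, mul_centre_mem_halfTree_iff hz, mul_maxCompact_mem_halfTree_iff hk']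

/-- A column operation in `K`, with the larger entry of the bottom row as pivot, clears the lower
left entry; a scalar then normalizes the lower right one. -/
theorem exists_iwasawa (s : GL (Fin 2) F) : ∃ b z k : GL (Fin 2) F, z ∈ centre F ∧
    k ∈ maxCompact F ∧ s = b * z * k ∧ b.1 1 0 = 0 ∧ b.1 1 1 = 1 := by
  obtain ⟨k, hk, h⟩ : ∃ k ∈ maxCompact F, (s * k).1 1 0 = 0 := by
    by_cases hs : valuation F (s.1 1 0) ≤ valuation F (s.1 1 1)
    · have h1 : s.1 1 1 ≠ 0 := by
        intro h1
        rw [h1, map_zero, le_zero_iff, map_eq_zero] at hs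
        exact (diag_ne_zero hs).2 h1
      refine ⟨Matrix.GeneralLinearGroup.mkOfDetNeZero !![1, 0; -(s.1 1 0 / s.1 1 1), 1]
        (by simp [Matrix.det_fin_two]), ?_, ?_⟩
      · rw [mem_maxCompact_iff]
        have h2 : valuation F (s.1 1 0) / valuation F (s.1 1 1) ≤ 1 :=
          div_le_one_of_le₀ hs zero_le
        refine ⟨fun i j => ?_, ?_⟩
        · fin_cases i <;> fin_cases j <;>
            simp [Matrix.GeneralLinearGroup.mkOfDetNeZero, h2]
        · simp [Matrix.GeneralLinearGroup.mkOfDetNeZero, Matrix.det_fin_two]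
      · rw [mul_fin_two]
        simp [Matrix.GeneralLinearGroup.mkOfDetNeZero]
        field_simp
        ring
    · have h1 : s.1 1 0 ≠ 0 := by
        intro h1
        rw [h1, map_zero] at hs
        exact hs zero_le
      refine ⟨Matrix.GeneralLinearGroup.mkOfDetNeZero !![-(s.1 1 1 / s.1 1 0), 1; 1, 0]
        (by simp [Matrix.det_fin_two]), ?_, ?_⟩
      · rw [mem_maxCompact_iff]
        have h2 : valuation F (s.1 1 1) / valuation F (s.1 1 0) ≤ 1 :=
          div_le_one_of_le₀ (not_le.1 hs).le zero_le
        refine ⟨fun i j => ?_, ?_⟩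
        · fin_cases i <;> fin_cases j <;>
            simp [Matrix.GeneralLinearGroup.mkOfDetNeZero, h2]
        · simp [Matrix.GeneralLinearGroup.mkOfDetNeZero, Matrix.det_fin_two]
      · rw [mul_fin_two]
        simp [Matrix.GeneralLinearGroup.mkOfDetNeZero]
        field_simp
        ring
  have h1 := (diag_ne_zero h).2
  have key : ∀ x : GL (Fin 2) F, ∀ (_ : x.1 1 0 = 0) (h1 : x.1 1 1 ≠ 0),
      (x * (scalarElt _ h1)⁻¹).1 1 1 = 1 := by
    intro x h h1
    rw [mul_fin_two, h, inv_fin_two]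
    simp [coe_scalarElt, Matrix.det_fin_two]
    field_simp
  refine ⟨s * k * (scalarElt _ h1)⁻¹, scalarElt _ h1, k⁻¹, scalarElt_mem _ _, inv_mem hk, by simp,
    ?_, ?_⟩
  · rw [mul_fin_two, h, inv_fin_two]
    simp [coe_scalarElt]
  · exact key _ h h1

/-- Right multiplication by `g` moves vertices a bounded distance, so only vertices close to the
boundary can leave the half-tree. Concretely, reduce `s` to `b` with rows `(α, β)` and `(0, 1)`,
where `|α|, |β| ≤ 1`; leaving forces `|α| ≥ C⁻²`, which confines `b` to a compact set. -/
theorem exists_finset_halfTree (g : GL (Fin 2) F) : ∃ T : Finset (GL (Fin 2) F),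
    ∀ s ∈ halfTree F, s * g ∉ halfTree F →
      ∃ τ ∈ T, τ⁻¹ * (s * g) ∈ maxCompact F ⊔ centre F := by
  obtain ⟨C, hC1, hC⟩ := exists_mem_boundedSet g
  -- The factor `C ^ 2` will bound `b` and its inverse, the factor `C` bounds `k * g`.
  obtain ⟨T, hT⟩ := exists_finset_cosets (isCompact_boundedSet (C ^ 2 * C)) (maxCompact F)
    isOpen_maxCompact
  refine ⟨T, fun s hs hsg => ?_⟩
  obtain ⟨b, z, k, hz, hk, rfl, hb0, hb1⟩ := exists_iwasawa s
  rw [mul_maxCompact_mem_halfTree_iff hk, mul_centre_mem_halfTree_iff hz] at hs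
  have hcomm : ∀ x, z * x = x * z := fun x => (Subgroup.mem_center_iff.1 hz x).symm
  have e : b * z * k * g = b * (k * g) * z := by
    simp only [mul_assoc]
    rw [← mul_assoc k g z, ← hcomm]
  rw [e] at hsg ⊢
  rw [mul_centre_mem_halfTree_iff hz] at hsg
  have hh : k * g ∈ boundedSet F C := by
    have hk' : k ∈ boundedSet F 1 := by
      rw [← coe_maxCompact]
      exact hk
    simpa using mul_mem_boundedSet hk' hC
  generalize k * g = h at hsg hh
  have hbrow : rowNorm 0 b ≤ 1 := by
    refine le_trans hs ?_
    simp [rowNorm, hb0, hb1]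
  have hbot : ∀ j, (b * h).1 1 j = h.1 1 j := fun j => by
    rw [mul_fin_two, hb0, hb1, zero_mul, one_mul, zero_add]
  have hbot' : rowNorm 1 (b * h) = rowNorm 1 h := by
    unfold rowNorm
    rw [hbot, hbot]
  have hone : 1 ≤ rowNorm 1 h * C := by
    have h1 : (h * h⁻¹).1 1 1 = 1 := by simp
    rw [mul_fin_two] at h1
    rw [← map_one (valuation F), ← h1]
    exact valuation_add_mul_le (mul_le_mul' (le_rowNorm _ _ _) (hh _ _).2)
      (mul_le_mul' (le_rowNorm _ _ _) (hh _ _).2)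
  -- The contribution of `β` to the top row of `b * h` never exceeds its bottom row, which is that
  -- of `h`; so it is the contribution of `α` that takes `b * h` out of the half-tree.
  have hlt : rowNorm 1 h < valuation F (b.1 0 0) * C := by
    by_contra hcon
    refine hsg ?_
    change rowNorm 0 (b * h) ≤ rowNorm 1 (b * h)
    rw [hbot']
    refine sup_le ?_ ?_ <;> rw [mul_fin_two] <;> refine valuation_add_mul_le ?_ ?_
    · exact (mul_le_mul' le_rfl (hh _ _).1).trans (not_lt.1 hcon)
    · exact mul_le_of_le_one_of_le ((le_rowNorm _ _ _).trans hbrow) (le_rowNorm _ _ _)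
    · exact (mul_le_mul' le_rfl (hh _ _).1).trans (not_lt.1 hcon)
    · exact mul_le_of_le_one_of_le ((le_rowNorm _ _ _).trans hbrow) (le_rowNorm _ _ _)
  have hα : 1 ≤ valuation F (b.1 0 0) * C ^ 2 :=
    calc (1 : ValueGroupWithZero F) ≤ rowNorm 1 h * C := hone
      _ ≤ valuation F (b.1 0 0) * C * C := mul_le_mul' hlt.le le_rfl
      _ = _ := by rw [mul_assoc, sq]
  have hα0 : 0 < valuation F (b.1 0 0) := by
    rw [Valuation.pos_iff]
    exact (diag_ne_zero hb0).1
  have hα' : (valuation F (b.1 0 0))⁻¹ ≤ C ^ 2 := by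
    rwa [inv_le_iff_one_le_mul₀' hα0]
  have hC2 : 1 ≤ C ^ 2 := one_le_pow₀ hC1
  have hb : b ∈ boundedSet F (C ^ 2) := by
    have h00 := (le_rowNorm 0 0 b).trans hbrow
    have h01 := (le_rowNorm 0 1 b).trans hbrow
    have hdet : b.1.det = b.1 0 0 := by
      rw [Matrix.det_fin_two, hb0, hb1]
      ring
    intro i j
    rw [inv_fin_two, hdet]
    fin_cases i <;> fin_cases j
    · simpa [hb1] using ⟨h00.trans hC2, hα'⟩
    · refine ⟨h01.trans hC2, ?_⟩
      simpa using (mul_le_of_le_of_le_one hα' h01)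
    · simp [hb0]
    · have := (diag_ne_zero hb0).1
      simpa [hb1, this] using hC2
  obtain ⟨τ, hτ, hk'⟩ := hT _ (mul_mem_boundedSet hb hh)
  refine ⟨τ, hτ, ?_⟩
  rw [← mul_assoc]
  exact mem_sup_centre_iff.2 ⟨_, hk', z, hz, rfl⟩

end GroupTheory

/-! ### Formal properties of spans of orbits -/

section OrbitSpan

variable {o G V : Type*} [CommRing o] [Group G] [AddCommGroup V] [Module o V]

theorem apply_mem_orbitSpan (ρ : Representation o G V) {S : Set G} {X : Set V} {s : G} {x : V}
    (hs : s ∈ S) (hx : x ∈ X) : ρ s x ∈ orbitSpan ρ S X :=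
  Submodule.subset_span ⟨s, hs, x, hx, rfl⟩

theorem orbitSpan_le {ρ : Representation o G V} {S : Set G} {X : Set V} {M : Submodule o V} :
    orbitSpan ρ S X ≤ M ↔ ∀ s ∈ S, ∀ x ∈ X, ρ s x ∈ M := by
  rw [orbitSpan, Submodule.span_le, Set.image2_subset_iff]
  rfl

theorem orbitSpan_mono (ρ : Representation o G V) {S S' : Set G} {X X' : Set V} (hS : S ⊆ S')
    (hX : X ⊆ X') : orbitSpan ρ S X ≤ orbitSpan ρ S' X' :=
  Submodule.span_mono (Set.image2_subset hS hX)

theorem apply_mem_orbitSpan_of_mul_mem (ρ : Representation o G V) {S S' : Set G} {X : Set V}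
    {g : G} (hg : ∀ s ∈ S, g * s ∈ S') {m : V} (hm : m ∈ orbitSpan ρ S X) :
    ρ g m ∈ orbitSpan ρ S' X := by
  have : orbitSpan ρ S X ≤ (orbitSpan ρ S' X).comap (ρ g) := orbitSpan_le.2 fun s hs x hx => by
    have := apply_mem_orbitSpan ρ (hg s hs) hx
    rwa [map_mul] at this
  exact this hm

end OrbitSpan

/-! ### The monoid `B⁺` in coordinates, and small compact open subgroups -/

section BorelPlus

variable {F : Type*} [Field F] [ValuativeRel F] [TopologicalSpace F] [IsNonarchimedeanLocalField F]
variable (ϖ : IntegerRing F) (hϖ : Irreducible ϖ)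

theorem coe_tElt_pow (n : ℕ) : (tElt ϖ hϖ ^ n).1 = !![(ϖ : F) ^ n, 0; 0, 1] := by
  induction n with
  | zero =>
    ext i j
    fin_cases i <;> fin_cases j <;> simp
  | succ n ih =>
    rw [pow_succ, Units.val_mul, ih]
    ext i j
    fin_cases i <;> fin_cases j <;>
      simp [tElt, Matrix.GeneralLinearGroup.mkOfDetNeZero, Matrix.mul_apply, pow_succ]

include hϖ in
theorem uniformizer_ne_zero : (ϖ : F) ≠ 0 := fun h => hϖ.ne_zero (Subtype.ext h)

theorem coe_tElt_pow_inv (n : ℕ) : ((tElt ϖ hϖ ^ n)⁻¹).1 = !![((ϖ : F) ^ n)⁻¹, 0; 0, 1] := by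
  have := uniformizer_ne_zero ϖ hϖ
  rw [inv_fin_two, coe_tElt_pow]
  ext i j
  fin_cases i <;> fin_cases j <;> simp [Matrix.det_fin_two, this]

theorem integer_isUnit_iff {x : IntegerRing F} : IsUnit x ↔ valuation F (x : F) = 1 := by
  constructor
  · rintro ⟨u, rfl⟩
    refine le_antisymm u.1.2 ?_
    have h : valuation F (u.1 : F) * valuation F (u⁻¹.1 : F) = 1 := by
      rw [← map_mul, ← Subring.coe_mul, u.mul_inv]
      simp
    calc (1 : ValueGroupWithZero F) = _ := h.symm
      _ ≤ valuation F (u.1 : F) * 1 := mul_le_mul' le_rfl u⁻¹.1.2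
      _ = _ := mul_one _
  · intro h
    have h0 : (x : F) ≠ 0 := by
      intro h0
      rw [h0, map_zero] at h
      exact zero_ne_one h
    refine IsUnit.of_mul_eq_one ⟨(x : F)⁻¹, ?_⟩ (Subtype.ext (mul_inv_cancel₀ h0))
    change valuation F (x : F)⁻¹ ≤ 1
    rw [map_inv₀, h, inv_one]

include hϖ in
theorem valuation_uniformizer_lt_one : valuation F (ϖ : F) < 1 :=
  lt_of_le_of_ne ϖ.2 fun h => hϖ.not_isUnit (integer_isUnit_iff.2 h)

include hϖ in
theorem valuation_uniformizer_pow_ne_zero (n : ℕ) : valuation F (ϖ : F) ^ n ≠ 0 :=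
  pow_ne_zero _ ((Valuation.ne_zero_iff _).2 (uniformizer_ne_zero ϖ hϖ))

include hϖ in
theorem exists_eq_unit_mul_pow {c : F} (hc : c ≠ 0) (hc1 : valuation F c ≤ 1) :
    ∃ n : ℕ, ∃ u : F, valuation F u = 1 ∧ c = u * (ϖ : F) ^ n := by
  obtain ⟨n, u, h⟩ := IsDiscreteValuationRing.eq_unit_mul_pow_irreducible
    (x := (⟨c, hc1⟩ : IntegerRing F)) (fun h => hc (congrArg Subtype.val h)) hϖ
  exact ⟨n, (u.1 : F), integer_isUnit_iff.1 u.isUnit, congrArg Subtype.val h⟩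

include hϖ in
theorem exists_forall_pow_lt {γ : ValueGroupWithZero F} (hγ : γ ≠ 0) :
    ∃ N : ℕ, ∀ n ≥ N, valuation F (ϖ : F) ^ n < γ := by
  obtain ⟨c, rfl⟩ := valuation_surjective γ
  have hlt := valuation_uniformizer_lt_one ϖ hϖ
  have h0 := valuation_uniformizer_pow_ne_zero ϖ hϖ
  have hpos : 0 < valuation F (ϖ : F) := zero_lt_iff.2 (by simpa using h0 1)
  rcases le_total (valuation F c) 1 with hc | hc
  · obtain ⟨N, u, hu, rfl⟩ := exists_eq_unit_mul_pow ϖ hϖ ((Valuation.ne_zero_iff _).1 hγ) hc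
    refine ⟨N + 1, fun n hn => ?_⟩
    rw [map_mul, hu, one_mul, map_pow]
    exact pow_lt_pow_right_of_lt_one₀ hpos hlt hn
  · exact ⟨1, fun n hn => (pow_lt_one₀ zero_le hlt (by lia)).trans_le hc⟩

/-- Divide by the lower right entry to remove the centre; what remains is integral, and its upper
left entry is a unit times `ϖ ^ n`, which gives the power of `t`. -/
theorem mem_borelPlus_iff {g : GL (Fin 2) F} : g ∈ borelPlus ϖ hϖ ↔
    g.1 1 0 = 0 ∧ valuation F (g.1 0 0) ≤ valuation F (g.1 1 1) ∧
      valuation F (g.1 0 1) ≤ valuation F (g.1 1 1) := by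
  constructor
  · rintro ⟨b, ⟨hb, hbK⟩, z, hz, n, rfl⟩
    obtain ⟨h1, h2, h3⟩ := mem_centre_iff.1 hz
    replace hb : b.1 1 0 = 0 := hb
    replace hbK : b ∈ maxCompact F := hbK
    obtain ⟨hb1, hb2⟩ := mem_maxCompact_iff.1 hbK
    have hb11 : valuation F (b.1 1 1) = 1 := by
      rw [Matrix.det_fin_two, hb, mul_zero, sub_zero, map_mul] at hb2
      refine le_antisymm (hb1 _ _) ?_
      calc (1 : ValueGroupWithZero F) = _ := hb2.symm
        _ ≤ 1 * valuation F (b.1 1 1) := mul_le_mul' (hb1 _ _) le_rfl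
        _ = _ := one_mul _
    have hn : valuation F (ϖ : F) ^ n ≤ 1 := pow_le_one₀ zero_le ϖ.2
    refine ⟨?_, ?_, ?_⟩
    · simp [mul_fin_two, -Units.val_mul, -Units.val_pow_eq_pow_val, coe_tElt_pow, hb, h2]
    · simp only [mul_fin_two, coe_tElt_pow, hb, h1, h2, h3]
      simp only [Matrix.of_apply, Matrix.cons_val', Matrix.cons_val_zero, Matrix.cons_val_one,
        mul_zero, zero_mul, add_zero, zero_add, mul_one, map_mul, map_pow, hb11, one_mul]
      exact mul_le_of_le_of_le_one (mul_le_of_le_one_left zero_le (hb1 _ _)) hn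
    · simp only [mul_fin_two, coe_tElt_pow, hb, h1, h2, h3]
      simp only [Matrix.of_apply, Matrix.cons_val', Matrix.cons_val_zero, Matrix.cons_val_one,
        mul_zero, zero_mul, add_zero, zero_add, mul_one, map_mul, hb11, one_mul]
      exact mul_le_of_le_one_left zero_le (hb1 _ _)
  · rintro ⟨h0, h1, h2⟩
    obtain ⟨ha, hd⟩ := diag_ne_zero h0
    have hd' : 0 < valuation F (g.1 1 1) := (Valuation.pos_iff _).2 hd
    obtain ⟨n, u, hu, hun⟩ := exists_eq_unit_mul_pow ϖ hϖ (div_ne_zero ha hd) (by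
      rw [map_div₀]
      exact div_le_one_of_le₀ h1 zero_le)
    have hu0 : u ≠ 0 := by
      rintro rfl
      simp at hu
    refine ⟨Matrix.GeneralLinearGroup.mkOfDetNeZero !![u, g.1 0 1 / g.1 1 1; 0, 1]
      (by simpa [Matrix.det_fin_two] using hu0), ⟨?_, ?_⟩, scalarElt _ hd, scalarElt_mem _ _, n,
      ?_⟩
    · simp [mem_borel_iff, Matrix.GeneralLinearGroup.mkOfDetNeZero]
    · have h3 : valuation F (g.1 0 1) / valuation F (g.1 1 1) ≤ 1 := div_le_one_of_le₀ h2 zero_le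
      refine mem_maxCompact_iff.2 ?_
      refine ⟨fun i j => ?_, ?_⟩
      · fin_cases i <;> fin_cases j <;>
          simp [Matrix.GeneralLinearGroup.mkOfDetNeZero, h3, hu]
      · simp [Matrix.GeneralLinearGroup.mkOfDetNeZero, Matrix.det_fin_two, hu]
    · refine Units.ext ?_
      rw [div_eq_iff hd] at hun
      ext i j
      simp only [mul_fin_two, coe_tElt_pow]
      fin_cases i <;> fin_cases j <;>
        simp [Matrix.GeneralLinearGroup.mkOfDetNeZero, coe_scalarElt, h0, hun, hd]
      ring

/-- This transfers the decomposition of `B` into `B⁺` and `B - B⁺` to that of the tree into a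
half-tree and its complement. -/
theorem mem_borelPlus_iff_mem_halfTree {g : GL (Fin 2) F} (hg : g ∈ borel F) :
    g ∈ borelPlus ϖ hϖ ↔ g ∈ halfTree F := by
  rw [mem_borel_iff] at hg
  rw [mem_borelPlus_iff]
  change _ ↔ rowNorm 0 g ≤ rowNorm 1 g
  simp [rowNorm, hg]

theorem borelPlus_subset_borel : borelPlus ϖ hϖ ⊆ borel F :=
  fun _ hg => ((mem_borelPlus_iff ϖ hϖ).1 hg).1

theorem borelPlus_subset_halfTree : borelPlus ϖ hϖ ⊆ halfTree F :=
  fun _ hg => (mem_borelPlus_iff_mem_halfTree ϖ hϖ (borelPlus_subset_borel ϖ hϖ hg)).1 hg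

theorem tElt_pow_mem_borel (n : ℕ) : tElt ϖ hϖ ^ n ∈ borel F := by
  rw [mem_borel_iff, coe_tElt_pow]
  simp

/-- `t⁻ⁿ` multiplies the ratio of the diagonal entries by `ϖ⁻ⁿ`, whose valuation eventually violates
the condition for `B⁺`. -/
theorem exists_tElt_pow_inv_mul_mem_diff {g : GL (Fin 2) F} (hg : g ∈ borel F) :
    ∃ N : ℕ, ∀ n ≥ N,
      (tElt ϖ hϖ ^ n)⁻¹ * g ∈ (borel F : Set (GL (Fin 2) F)) \ borelPlus ϖ hϖ := by
  obtain ⟨ha, hd⟩ := diag_ne_zero hg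
  obtain ⟨N, hN⟩ := exists_forall_pow_lt ϖ hϖ
    (γ := valuation F (g.1 0 0 / g.1 1 1)) ((Valuation.ne_zero_iff _).2 (div_ne_zero ha hd))
  refine ⟨N, fun n hn => ⟨mul_mem (inv_mem (tElt_pow_mem_borel ϖ hϖ n)) hg, fun h => ?_⟩⟩
  have h1 := ((mem_borelPlus_iff ϖ hϖ).1 h).2.1
  simp only [mul_fin_two, coe_tElt_pow_inv] at h1
  simp only [Matrix.of_apply, Matrix.cons_val', Matrix.cons_val_zero, Matrix.cons_val_one,
    zero_mul, add_zero, zero_add, one_mul, map_mul, map_pow, map_inv₀] at h1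
  have h2 := hN n hn
  have hd' : 0 < valuation F (g.1 1 1) := (Valuation.pos_iff _).2 hd
  have hp : 0 < valuation F (ϖ : F) ^ n :=
    zero_lt_iff.2 (valuation_uniformizer_pow_ne_zero ϖ hϖ n)
  rw [map_div₀, lt_div_iff₀ hd'] at h2
  rw [inv_mul_le_iff₀ hp] at h1
  exact absurd h1 (not_le.2 h2)

/-- The unipotent matrix with upper right entry `y`. -/
def unipotentElt (y : F) : GL (Fin 2) F :=
  Matrix.GeneralLinearGroup.mkOfDetNeZero !![1, y; 0, 1] (by simp [Matrix.det_fin_two])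

theorem coe_unipotentElt (y : F) : (unipotentElt y).1 = !![1, y; 0, 1] := rfl

theorem unipotentElt_mem_iff {y : F} : unipotentElt y ∈ unipotentInt F ↔ valuation F y ≤ 1 := by
  constructor
  · intro h
    exact (mem_maxCompact_iff.1 h.2).1 0 1
  · intro h
    refine ⟨by simp [unipotent, coe_unipotentElt], mem_maxCompact_iff.2 ⟨fun i j => ?_, ?_⟩⟩
    · fin_cases i <;> fin_cases j <;> simp [coe_unipotentElt, h]
    · simp [coe_unipotentElt, Matrix.det_fin_two]

theorem eq_unipotentElt {u : GL (Fin 2) F} (hu : u ∈ unipotentInt F) :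
    u = unipotentElt (u.1 0 1) := by
  obtain ⟨⟨h1, h2, h3⟩, -⟩ := hu
  refine Units.ext ?_
  ext i j
  fin_cases i <;> fin_cases j <;> simp [coe_unipotentElt, h1, h2, h3]

theorem unipotentElt_add (x y : F) : unipotentElt (x + y) = unipotentElt x * unipotentElt y := by
  refine Units.ext ?_
  ext i j
  rw [mul_fin_two]
  fin_cases i <;> fin_cases j <;> simp [coe_unipotentElt, add_comm]

theorem unipotentElt_zero : unipotentElt (0 : F) = 1 := by
  refine Units.ext ?_
  ext i j
  fin_cases i <;> fin_cases j <;> simp [coe_unipotentElt]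

/-- With `d` the lower right entry of `g`, the term `y * d` dominates the new upper right entry, and
its valuation exceeds that of `d`. -/
theorem unipotentElt_mul_mem_diff {y : F} (hy : 1 < valuation F y) {g : GL (Fin 2) F}
    (hg : g ∈ borelPlus ϖ hϖ) :
    unipotentElt y * g ∈ (borel F : Set (GL (Fin 2) F)) \ borelPlus ϖ hϖ := by
  obtain ⟨h0, h1, h2⟩ := (mem_borelPlus_iff ϖ hϖ).1 hg
  have hd' : 0 < valuation F (g.1 1 1) := (Valuation.pos_iff _).2 (diag_ne_zero h0).2
  refine ⟨?_, fun h => ?_⟩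
  · rw [SetLike.mem_coe, mem_borel_iff, mul_fin_two, h0]
    simp [coe_unipotentElt]
  · have h3 := ((mem_borelPlus_iff ϖ hϖ).1 h).2.2
    simp only [mul_fin_two, coe_unipotentElt] at h3
    simp only [Matrix.of_apply, Matrix.cons_val', Matrix.cons_val_zero, Matrix.cons_val_one,
      zero_mul, zero_add, one_mul] at h3
    have h4 : valuation F (g.1 1 1) < valuation F (y * g.1 1 1) := by
      rw [map_mul]
      exact lt_mul_of_one_lt_left hd' hy
    rw [Valuation.map_add_eq_of_lt_right (valuation F) (h2.trans_lt h4)] at h3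
    exact absurd h3 (not_le.2 h4)

/-- The matrices of `GL(2, O_F)` that are upper triangular unipotent modulo `ϖⁿ`. -/
def unipotentMod (n : ℕ) : Subgroup (GL (Fin 2) F) where
  carrier := {g | g ∈ maxCompact F ∧ valuation F (g.1 1 0) ≤ valuation F (ϖ : F) ^ n ∧
    valuation F (g.1 0 0 - 1) ≤ valuation F (ϖ : F) ^ n ∧
    valuation F (g.1 1 1 - 1) ≤ valuation F (ϖ : F) ^ n}
  one_mem' := ⟨one_mem _, by simp, by simp, by simp⟩
  mul_mem' := by
    rintro g h ⟨hg, g1, g2, g3⟩ ⟨hh, h1, h2, h3⟩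
    have vg := (mem_maxCompact_iff.1 hg).1
    have vh := (mem_maxCompact_iff.1 hh).1
    refine ⟨mul_mem hg hh, ?_, ?_, ?_⟩
    · rw [mul_fin_two]
      exact valuation_add_mul_le (mul_le_of_le_of_le_one g1 (vh _ _))
        (mul_le_of_le_one_of_le (vg _ _) h1)
    · have e : (g * h).1 0 0 - 1 =
          (g.1 0 0 - 1) * h.1 0 0 + 1 * (h.1 0 0 - 1) + g.1 0 1 * h.1 1 0 := by
        rw [mul_fin_two]
        ring
      rw [e]
      refine (Valuation.map_add _ _ _).trans (max_le (valuation_add_mul_le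
        (mul_le_of_le_of_le_one g2 (vh _ _)) (by simpa using h2)) ?_)
      rw [map_mul]
      exact mul_le_of_le_one_of_le (vg _ _) h1
    · have e : (g * h).1 1 1 - 1 =
          (g.1 1 1 - 1) * h.1 1 1 + 1 * (h.1 1 1 - 1) + g.1 1 0 * h.1 0 1 := by
        rw [mul_fin_two]
        ring
      rw [e]
      refine (Valuation.map_add _ _ _).trans (max_le (valuation_add_mul_le
        (mul_le_of_le_of_le_one g3 (vh _ _)) (by simpa using h3)) ?_)
      rw [map_mul]
      exact mul_le_of_le_of_le_one g1 (vh _ _)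
  inv_mem' := by
    rintro g ⟨hg, g1, g2, g3⟩
    obtain ⟨vg, vdet⟩ := mem_maxCompact_iff.1 hg
    have hdet : g.1.det ≠ 0 := fun h => by simp [h] at vdet
    -- The determinant is a unit, so its inverse in the formula for `g⁻¹` does not affect
    -- valuations.
    have aux : ∀ x y : F, valuation F (y * (1 - x) + g.1 0 1 * g.1 1 0) =
        valuation F (g.1.det⁻¹ * (y * (1 - x) + g.1 0 1 * g.1 1 0)) := fun x y => by
      rw [map_mul, map_inv₀, vdet, inv_one, one_mul]
    refine ⟨inv_mem hg, ?_, ?_, ?_⟩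
    · rw [inv_fin_two]
      simpa [vdet] using g1
    · have e : g⁻¹.1 0 0 - 1 = g.1.det⁻¹ * (g.1 1 1 * (1 - g.1 0 0) + g.1 0 1 * g.1 1 0) := by
        rw [inv_fin_two]
        simp only [Matrix.smul_apply, Matrix.of_apply, Matrix.cons_val', Matrix.cons_val_zero,
          smul_eq_mul]
        field_simp
        rw [Matrix.det_fin_two]
        ring
      rw [e, ← aux]
      refine valuation_add_mul_le (mul_le_of_le_one_of_le (vg _ _) ?_)
        (mul_le_of_le_one_of_le (vg _ _) g1)
      rwa [Valuation.map_sub_swap]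
    · have e : g⁻¹.1 1 1 - 1 = g.1.det⁻¹ * (g.1 0 0 * (1 - g.1 1 1) + g.1 0 1 * g.1 1 0) := by
        rw [inv_fin_two]
        simp only [Matrix.smul_apply, Matrix.of_apply, Matrix.cons_val', Matrix.cons_val_one,
          smul_eq_mul]
        field_simp
        rw [Matrix.det_fin_two]
        simp
        ring
      rw [e, ← aux]
      refine valuation_add_mul_le (mul_le_of_le_one_of_le (vg _ _) ?_)
        (mul_le_of_le_one_of_le (vg _ _) g1)
      rwa [Valuation.map_sub_swap]

theorem unipotentInt_le_unipotentMod (n : ℕ) : unipotentInt F ≤ unipotentMod ϖ n := by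
  rintro u ⟨⟨h1, h2, h3⟩, hK⟩
  exact ⟨hK, by simp [h1], by simp [h2], by simp [h3]⟩

include hϖ in
theorem isOpen_unipotentMod (n : ℕ) : IsOpen (unipotentMod ϖ n : Set (GL (Fin 2) F)) := by
  have h0 := valuation_uniformizer_pow_ne_zero ϖ hϖ n
  exact isOpen_maxCompact.inter ((isOpen_setOf_valuation_le (continuous_entry 1 0) h0).inter
    ((isOpen_setOf_valuation_le ((continuous_entry 0 0).sub continuous_const) h0).inter
      (isOpen_setOf_valuation_le ((continuous_entry 1 1).sub continuous_const) h0)))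

include hϖ in
theorem isCompact_unipotentMod (n : ℕ) :
    IsCompact (unipotentMod ϖ n : Set (GL (Fin 2) F)) :=
  isCompact_maxCompact.of_isClosed_subset
    (Subgroup.isClosed_of_isOpen _ (isOpen_unipotentMod ϖ hϖ n)) fun _ h => h.1

include hϖ in
-- The congruence subgroups are compact and decreasing with intersection `{1}`, so one of them lies
-- in the given neighbourhood.
theorem exists_principal_subset {H : Set (GL (Fin 2) F)} (hH : H ∈ 𝓝 1) : ∃ n : ℕ, 1 ≤ n ∧
    ∀ g ∈ maxCompact F, (∀ i j, valuation F (g.1 i j - (1 : Matrix (Fin 2) (Fin 2) F) i j) ≤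
      valuation F (ϖ : F) ^ n) → g ∈ H := by
  have := t2Space (F := F)
  let A : ℕ → Set (GL (Fin 2) F) := fun n => {g | g ∈ maxCompact F ∧
    ∀ i j, valuation F (g.1 i j - (1 : Matrix (Fin 2) (Fin 2) F) i j) ≤ valuation F (ϖ : F) ^ n}
  have hanti : ∀ m n, m ≤ n → A n ⊆ A m := fun m n h g hg =>
    ⟨hg.1, fun i j => (hg.2 i j).trans (pow_le_pow_right_of_le_one' ϖ.2 h)⟩
  have hdir : Directed (· ⊇ ·) A := directed_of_isDirected_le fun m n h => hanti m n h
  have hcomp : ∀ n, IsCompact (A n) := fun n => by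
    refine (isCompact_maxCompact (F := F)).inter_right ?_
    change IsClosed {g : GL (Fin 2) F | ∀ i j, valuation F
      (g.1 i j - (1 : Matrix (Fin 2) (Fin 2) F) i j) ≤ valuation F (ϖ : F) ^ n}
    have e : {g : GL (Fin 2) F | ∀ i j, valuation F
        (g.1 i j - (1 : Matrix (Fin 2) (Fin 2) F) i j) ≤ valuation F (ϖ : F) ^ n} =
        ⋂ i, ⋂ j, (fun g : GL (Fin 2) F => g.1 i j - (1 : Matrix (Fin 2) (Fin 2) F) i j) ⁻¹'
          {x | valuation F x ≤ valuation F (ϖ : F) ^ n} := by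
      ext g
      simp
    rw [e]
    exact isClosed_iInter fun i => isClosed_iInter fun j =>
      (IsNonarchimedeanLocalField.isCompact_closedBall F _).isClosed.preimage
        ((continuous_entry i j).sub continuous_const)
  obtain ⟨n, hn⟩ := exists_subset_nhds_of_isCompact hdir hcomp (U := H) fun g hg => by
    have : g = 1 := by
      refine Units.ext ?_
      ext i j
      by_contra hne
      obtain ⟨N, hN⟩ := exists_forall_pow_lt ϖ hϖ
        ((Valuation.ne_zero_iff (valuation F)).2 (sub_ne_zero.2 hne))
      exact absurd ((Set.mem_iInter.1 hg N).2 i j) (not_le.2 (hN N le_rfl))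
    rw [this]
    exact hH
  exact ⟨n + 1, by lia, fun g hg h => hn (hanti n (n + 1) (by lia) ⟨hg, h⟩)⟩

end BorelPlus

/-! ### Hecke operators: invariants of `⟨B⁺Y⟩` lie in `⟨(B - B⁺)Y⟩` -/

section Hecke

variable {o G V : Type*} [CommRing o] [Group G] [AddCommGroup V] [Module o V]

theorem finite_image_of_isCompact [TopologicalSpace G] [IsTopologicalGroup G]
    {ρ : Representation o G V} (hρ : IsSmooth ρ) {K : Set G} (hK : IsCompact K) (v : V) :
    ((fun k => ρ k v) '' K).Finite := by
  obtain ⟨H, hH⟩ := hρ v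
  obtain ⟨T, hT⟩ := exists_finset_cosets hK H.toSubgroup H.isOpen
  refine (T.finite_toSet.image fun k => ρ k v).subset ?_
  rintro _ ⟨k, hk, rfl⟩
  obtain ⟨τ, hτ, h⟩ := hT k hk
  refine ⟨τ, hτ, ?_⟩
  have := congrArg (ρ τ) (hH _ h)
  rw [← Module.End.mul_apply, ← map_mul, mul_inv_cancel_left] at this
  exact this.symm

/-- The action on an invariant vector `v` of the Hecke operator of `J a J`. -/
theorem exists_hecke [TopologicalSpace G] [IsTopologicalGroup G]
    (ρ : Representation o G V) (J : Subgroup G) (hJc : IsCompact (J : Set G))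
    (hJo : IsOpen (J : Set G)) (a : G) (v : V) (hv : ∀ j ∈ J, ρ j v = v) :
    ∃ w : V, (∀ j ∈ J, ρ j w = w) ∧ ∀ N : Submodule o V,
      (∀ j ∈ J, a⁻¹ * j * a ∉ J → ρ (a⁻¹ * j * a) v ∈ N) → ρ a⁻¹ w - v ∈ N := by
  classical
  have : CompactSpace J := isCompact_iff_compactSpace.1 hJc
  -- `L` is `J ∩ a J a⁻¹`, of finite index in `J`. Since `J` fixes `v`, the vector `j a v` depends
  -- only on the coset `j L`; the sum over these cosets is the Hecke operator.
  let L : Subgroup J := J.comap ((MulAut.conj a⁻¹).toMonoidHom.comp J.subtype)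
  have hLmem : ∀ j : J, j ∈ L ↔ a⁻¹ * j * a ∈ J := fun j => by
    simp [L, Subgroup.mem_comap]
  have hLo : IsOpen (L : Set J) := by
    have e : (L : Set J) = (fun j : J => a⁻¹ * (j : G) * a) ⁻¹' J := by
      ext j
      exact hLmem j
    rw [e]
    exact hJo.preimage (by fun_prop)
  have : Finite (J ⧸ L) := Subgroup.quotient_finite_of_isOpen L hLo
  have := Fintype.ofFinite (J ⧸ L)
  let f : J ⧸ L → V := fun q => ρ ((q.out : J) * a) v
  have hf : ∀ j : J, f j = ρ (j * a) v := by
    intro j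
    obtain ⟨l, hl⟩ := QuotientGroup.mk_out_eq_mul L j
    have e : ((j * l.1 : J) : G) * a = j * a * (a⁻¹ * l.1 * a) := by
      push_cast
      group
    change ρ (((QuotientGroup.mk j : J ⧸ L).out : J) * a) v = _
    rw [hl, e, map_mul, Module.End.mul_apply, hv _ ((hLmem _).1 l.2)]
  refine ⟨∑ q, f q, fun j hj => ?_, fun N hN => ?_⟩
  · rw [map_sum, ← (MulAction.bijective (⟨j, hj⟩ : J)).sum_comp f]
    refine Finset.sum_congr rfl fun q _ => ?_
    induction q using QuotientGroup.induction_on with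
    | H x =>
      rw [hf, MulAction.Quotient.smul_coe, hf, ← Module.End.mul_apply, ← map_mul, smul_eq_mul,
        Subgroup.coe_mul, mul_assoc]
  -- The trivial coset contributes `v`, which cancels; a nontrivial coset has `a⁻¹ j a ∉ J`.
  · have e : ρ a⁻¹ (∑ q, f q) - v =
        ∑ q, (ρ a⁻¹ (f q) - if q = ((1 : J) : J ⧸ L) then v else 0) := by
      rw [Finset.sum_sub_distrib, map_sum, Finset.sum_ite_eq' Finset.univ, if_pos (by simp)]
    rw [e]
    refine Submodule.sum_mem _ fun q _ => ?_
    have e2 : ∀ j : J, ρ a⁻¹ (f j) = ρ (a⁻¹ * j * a) v := fun j => by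
      rw [hf, ← Module.End.mul_apply, ← map_mul, mul_assoc]
    split_ifs with h
    · rw [h, e2]
      simp
    · induction q using QuotientGroup.induction_on with
      | H x =>
        rw [sub_zero, e2]
        refine hN x x.2 fun hx => h ?_
        rw [eq_comm, QuotientGroup.eq]
        simpa using (hLmem x).2 hx

variable {F : Type*} [Field F] [ValuativeRel F] [TopologicalSpace F] [IsNonarchimedeanLocalField F]
variable (ϖ : IntegerRing F) (hϖ : Irreducible ϖ)

include hϖ in
-- As `n ≥ 1`, the lower right entry is a unit, so an element of `U₀` clears the upper right entry:
-- this is an Iwahori factorization.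
theorem exists_eq_unipotentElt_mul {n : ℕ} (hn : 1 ≤ n) {j : GL (Fin 2) F}
    (hj : j ∈ unipotentMod ϖ n) : ∃ x : F, valuation F x ≤ 1 ∧ ∃ k ∈ unipotentMod ϖ n,
      k.1 0 1 = 0 ∧ j = unipotentElt x * k := by
  have hlt : valuation F (ϖ : F) ^ n < 1 :=
    pow_lt_one₀ zero_le (valuation_uniformizer_lt_one ϖ hϖ) (by lia)
  have h11 : valuation F (j.1 1 1) = 1 := by
    have := Valuation.map_one_add_of_lt (valuation F) (hj.2.2.2.trans_lt hlt)
    simpa using this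
  have h110 : j.1 1 1 ≠ 0 := fun h => by simp [h] at h11
  have hx : valuation F (-(j.1 0 1 / j.1 1 1)) ≤ 1 := by
    rw [Valuation.map_neg, map_div₀, h11, div_one]
    exact (mem_maxCompact_iff.1 hj.1).1 _ _
  refine ⟨j.1 0 1 / j.1 1 1, by simpa using hx, unipotentElt (-(j.1 0 1 / j.1 1 1)) * j,
    mul_mem (unipotentInt_le_unipotentMod ϖ n (unipotentElt_mem_iff.2 hx)) hj, ?_, ?_⟩
  · rw [mul_fin_two]
    simp [coe_unipotentElt, h110]
  · rw [← mul_assoc, ← unipotentElt_add, add_neg_cancel, unipotentElt_zero, one_mul]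

include hϖ in
-- In the factorization above, `U₀` fixes `v` by hypothesis and the lower triangular factor is close
-- to `1`, so smoothness applies to it. The resulting level is open although it contains all of
-- `U₀`.
theorem exists_unipotentMod_fix {ρ : Representation o (GL (Fin 2) F) V} (hρ : IsSmooth ρ) {v : V}
    (hv : ∀ u ∈ unipotentInt F, ρ u v = v) :
    ∃ n : ℕ, 1 ≤ n ∧ ∀ j ∈ unipotentMod ϖ n, ρ j v = v := by
  obtain ⟨H, hH⟩ := hρ v
  obtain ⟨n, hn, h⟩ := exists_principal_subset ϖ hϖ H.mem_nhds_one
  refine ⟨n, hn, fun j hj => ?_⟩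
  obtain ⟨x, hx, k, ⟨hkK, k1, k2, k3⟩, hk, rfl⟩ := exists_eq_unipotentElt_mul ϖ hϖ hn hj
  rw [map_mul, Module.End.mul_apply, hH k (h k hkK fun i j => ?_),
    hv _ (unipotentElt_mem_iff.2 hx)]
  fin_cases i <;> fin_cases j
  · simpa using k2
  · simp [hk]
  · simpa using k1
  · simpa using k3

theorem conj_unipotentElt (m : ℕ) (x : F) :
    (tElt ϖ hϖ ^ m)⁻¹ * unipotentElt x * tElt ϖ hϖ ^ m = unipotentElt (x / (ϖ : F) ^ m) := by
  have h := uniformizer_ne_zero ϖ hϖ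
  refine Units.ext ?_
  ext i j
  simp only [mul_fin_two, coe_tElt_pow, coe_tElt_pow_inv, coe_unipotentElt]
  fin_cases i <;> fin_cases j <;> simp [h, div_eq_inv_mul]

/-- Conjugation by `t⁻ᵐ` shrinks the lower left entry and would enlarge the upper right one, which
is why the latter must vanish. -/
theorem conj_mem_unipotentMod (m : ℕ) {n : ℕ} {k : GL (Fin 2) F} (hk : k ∈ unipotentMod ϖ n)
    (h01 : k.1 0 1 = 0) : (tElt ϖ hϖ ^ m)⁻¹ * k * tElt ϖ hϖ ^ m ∈ unipotentMod ϖ n := by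
  have h := uniformizer_ne_zero ϖ hϖ
  have hm : valuation F (ϖ : F) ^ m ≤ 1 := pow_le_one₀ zero_le ϖ.2
  obtain ⟨hkK, k1, k2, k3⟩ := hk
  obtain ⟨vk, vdet⟩ := mem_maxCompact_iff.1 hkK
  have e : ((tElt ϖ hϖ ^ m)⁻¹ * k * tElt ϖ hϖ ^ m).1 =
      !![k.1 0 0, 0; k.1 1 0 * (ϖ : F) ^ m, k.1 1 1] := by
    ext i j
    simp only [mul_fin_two, coe_tElt_pow, coe_tElt_pow_inv]
    fin_cases i <;> fin_cases j <;> simp [h01]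
    field_simp
  have h10 : valuation F (k.1 1 0) * valuation F (ϖ : F) ^ m ≤ valuation F (k.1 1 0) :=
    mul_le_of_le_one_right zero_le hm
  refine ⟨mem_maxCompact_iff.2 ⟨fun i j => ?_, ?_⟩, ?_, ?_, ?_⟩
  · rw [e]
    fin_cases i <;> fin_cases j <;> simp [vk]
    exact h10.trans (vk _ _)
  · rw [e]
    rw [Matrix.det_fin_two, h01, zero_mul, sub_zero] at vdet
    simpa [Matrix.det_fin_two] using vdet
  · rw [e]
    simpa using h10.trans k1
  · rw [e]
    simpa using k2
  · rw [e]
    simpa using k3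

theorem eventually_tElt_pow_inv_mem (ρ : Representation o (GL (Fin 2) F) V) (Y : Set V) {w : V}
    (hw : w ∈ orbitSpan ρ (borel F) Y) : ∃ N : ℕ, ∀ n ≥ N,
      ρ (tElt ϖ hϖ ^ n)⁻¹ w ∈
        orbitSpan ρ ((borel F : Set (GL (Fin 2) F)) \ borelPlus ϖ hϖ) Y := by
  unfold orbitSpan at hw
  induction hw using Submodule.span_induction with
  | mem x hx =>
    obtain ⟨b, hb, y, hy, rfl⟩ := hx
    obtain ⟨N, hN⟩ := exists_tElt_pow_inv_mul_mem_diff ϖ hϖ hb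
    refine ⟨N, fun n hn => ?_⟩
    change ρ _ (ρ b y) ∈ _
    rw [← Module.End.mul_apply, ← map_mul]
    exact apply_mem_orbitSpan ρ (hN n hn) hy
  | zero => exact ⟨0, fun n _ => by simp⟩
  | add x y _ _ hx hy =>
    obtain ⟨N, hN⟩ := hx
    obtain ⟨N', hN'⟩ := hy
    refine ⟨max N N', fun n hn => ?_⟩
    rw [map_add]
    exact add_mem (hN n (le_of_max_le_left hn)) (hN' n (le_of_max_le_right hn))
  | smul a x _ hx =>
    obtain ⟨N, hN⟩ := hx
    refine ⟨N, fun n hn => ?_⟩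
    rw [map_smul]
    exact Submodule.smul_mem _ _ (hN n hn)

/-- `t⁻ⁿ` pushes any fixed vector of `V` into `N`, whereas `t⁻ⁿwₙ` stays congruent to `v` modulo
`N`. Finiteness of `V^J` forces some fixed `w` to serve as `wₙ` for arbitrarily large `n`, so `v ∈
N`. -/
theorem mem_orbitSpan_diff_of_invariant {ρ : Representation o (GL (Fin 2) F) V} (hρ : IsSmooth ρ)
    (hfin : ∀ H : Subgroup (GL (Fin 2) F), IsOpen (H : Set (GL (Fin 2) F)) →
      IsCompact (H : Set (GL (Fin 2) F)) → {v | ∀ h ∈ H, ρ h v = v}.Finite)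
    {Y : Set V} (hY : orbitSpan ρ (borel F) Y = ⊤) {v : V}
    (hv : v ∈ orbitSpan ρ (borelPlus ϖ hϖ) Y) (hinv : ∀ u ∈ unipotentInt F, ρ u v = v) :
    v ∈ orbitSpan ρ ((borel F : Set (GL (Fin 2) F)) \ borelPlus ϖ hϖ) Y := by
  set N := orbitSpan ρ ((borel F : Set (GL (Fin 2) F)) \ borelPlus ϖ hϖ) Y with hN
  obtain ⟨m, hm, hJ⟩ := exists_unipotentMod_fix ϖ hϖ hρ hinv
  have hJc := isCompact_unipotentMod ϖ hϖ m
  have hJo := isOpen_unipotentMod ϖ hϖ m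
  choose w hwJ hw using fun n : ℕ =>
    exists_hecke ρ (unipotentMod ϖ m) hJc hJo (tElt ϖ hϖ ^ n) v hJ
  -- A nontrivial term is `u k' v` with `k' ∈ J` fixing `v` and `u` unipotent; `u` is not integral,
  -- as otherwise `u k'` would be in `J`. Such a `u` carries `⟨B⁺Y⟩` into `N`.
  have hwv : ∀ n, ρ (tElt ϖ hϖ ^ n)⁻¹ (w n) - v ∈ N := by
    intro n
    refine hw n N fun j hj hj' => ?_
    obtain ⟨x, hx, k, hk, hk01, rfl⟩ := exists_eq_unipotentElt_mul ϖ hϖ hm hj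
    have hk' := conj_mem_unipotentMod ϖ hϖ n hk hk01
    have e : (tElt ϖ hϖ ^ n)⁻¹ * (unipotentElt x * k) * tElt ϖ hϖ ^ n =
        unipotentElt (x / (ϖ : F) ^ n) * ((tElt ϖ hϖ ^ n)⁻¹ * k * tElt ϖ hϖ ^ n) := by
      rw [← conj_unipotentElt ϖ hϖ]
      group
    rw [e] at hj' ⊢
    rw [map_mul, Module.End.mul_apply, hJ _ hk']
    refine apply_mem_orbitSpan_of_mul_mem ρ (fun s hs => ?_) hv
    refine unipotentElt_mul_mem_diff ϖ hϖ (not_le.1 fun hle => hj' ?_) hs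
    exact mul_mem (unipotentInt_le_unipotentMod ϖ m (unipotentElt_mem_iff.2 hle)) hk'
  have : Finite {v | ∀ h ∈ unipotentMod ϖ m, ρ h v = v} := hfin _ hJo hJc
  obtain ⟨w₀, hw₀⟩ := Finite.exists_infinite_fiber
    (fun n : ℕ => (⟨w n, hwJ n⟩ : {v | ∀ h ∈ unipotentMod ϖ m, ρ h v = v}))
  obtain ⟨M, hM⟩ := eventually_tElt_pow_inv_mem ϖ hϖ ρ Y (w := w₀) (hY ▸ Submodule.mem_top)
  obtain ⟨n, hn, hMn⟩ := (Set.infinite_coe_iff.1 hw₀).exists_gt M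
  have hnw : w n = w₀ := congrArg Subtype.val hn
  have h := sub_mem (hM n hMn.le) (hnw ▸ hwv n)
  rwa [sub_sub_cancel] at h

end Hecke

/-! ### Truncation of relations in an induced representation -/

section Induced

variable {o G V : Type*} [CommRing o] [Group G] [AddCommGroup V] [Module o V]

theorem indV_mem {H : Subgroup G} {σ : Representation o H V}
    {N : Submodule o (Representation.IndV H.subtype σ)}
    (h : ∀ g v, Representation.IndV.mk H.subtype σ g v ∈ N)
    (x : Representation.IndV H.subtype σ) : x ∈ N := by
  have e : N.mkQ = 0 := Representation.IndV.hom_ext _ _ fun g => LinearMap.ext fun v => by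
    simpa using h g v
  rw [← Submodule.ker_mkQ N, e]
  rfl

theorem indV_mk_mul {H : Subgroup G} (σ : Representation o H V) (h : H) (g : G) (v : V) :
    Representation.IndV.mk H.subtype σ (h * g) (σ h v) =
      Representation.IndV.mk H.subtype σ g v := by
  have := Representation.Coinvariants.mk_self_apply
    (Representation.tprod ((Representation.leftRegular o G).comp H.subtype) σ) h
    (TensorProduct.tmul o (MonoidAlgebra.single g 1) v)
  simpa using this

/-- The smooth vectors of a representation. -/
def smoothVectors [TopologicalSpace G] (ρ : Representation o G V) : Submodule o V where
  carrier := {v | ∃ H : OpenSubgroup G, ∀ h ∈ H, ρ h v = v}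
  zero_mem' := ⟨⊤, fun _ _ => map_zero _⟩
  add_mem' := by
    rintro v w ⟨H, hH⟩ ⟨H', hH'⟩
    exact ⟨H ⊓ H', fun h hh => by rw [map_add, hH h hh.1, hH' h hh.2]⟩
  smul_mem' := by
    rintro a v ⟨H, hH⟩
    exact ⟨H, fun h hh => by rw [map_smul, hH h hh]⟩

/-- The vectors with a finite orbit under a set `Z`. -/
def orbitFiniteVectors (ρ : Representation o G V) (Z : Set G) : Submodule o V where
  carrier := {v | ((fun z => ρ z v) '' Z).Finite}
  zero_mem' := by
    refine (Set.finite_singleton (0 : V)).subset ?_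
    rintro _ ⟨z, -, rfl⟩
    simp
  add_mem' := by
    intro v w hv hw
    refine (hv.image2 (· + ·) hw).subset ?_
    rintro _ ⟨z, hz, rfl⟩
    exact ⟨_, ⟨z, hz, rfl⟩, _, ⟨z, hz, rfl⟩, (map_add _ _ _).symm⟩
  smul_mem' := by
    intro a v hv
    refine (hv.image (a • ·)).subset ?_
    rintro _ ⟨z, hz, rfl⟩
    exact ⟨_, ⟨z, hz, rfl⟩, (map_smul _ _ _).symm⟩

/-- If the open subgroup `L ≤ H` fixes `w`, then `g⁻¹ L g` fixes the class `[g, w]`, and such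
classes span. -/
theorem isSmooth_ind [TopologicalSpace G] [IsTopologicalGroup G] {ρ : Representation o G V}
    (hρ : IsSmooth ρ) {H K : Subgroup G} (hK : IsOpen (K : Set G)) (hKH : K ≤ H)
    (W : Submodule o V) (hW : IsStable ρ H W) :
    IsSmooth (Representation.ind H.subtype (subRep ρ H W hW)) := by
  intro x
  suffices h : x ∈ smoothVectors (Representation.ind H.subtype (subRep ρ H W hW)) from h
  refine indV_mem (fun g w => ?_) x
  obtain ⟨J, hJ⟩ := hρ w
  let L : OpenSubgroup G := J ⊓ ⟨K, hK⟩
  refine ⟨L.comap (MulAut.conj g).toMonoidHom (by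
    change Continuous fun x => g * x * g⁻¹
    fun_prop), fun η hη => ?_⟩
  have hη' : (g * η * g⁻¹)⁻¹ ∈ L := inv_mem hη
  have hfix : subRep ρ H W hW ⟨(g * η * g⁻¹)⁻¹, hKH hη'.2⟩ w = w := Subtype.ext (hJ _ hη'.1)
  have key := indV_mk_mul (subRep ρ H W hW) ⟨(g * η * g⁻¹)⁻¹, hKH hη'.2⟩ g w
  rw [hfix] at key
  rw [Representation.ind_mk, ← key]
  congr 2
  group

theorem exists_indV_eq_sum {H : Subgroup G} {σ : Representation o H V}
    (x : Representation.IndV H.subtype σ) :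
    ∃ f : G →₀ V, x = ∑ g ∈ f.support, Representation.IndV.mk H.subtype σ g (f g) := by
  suffices h : x ∈ LinearMap.range (Finsupp.lsum o (Representation.IndV.mk H.subtype σ)) by
    obtain ⟨f, rfl⟩ := h
    exact ⟨f, rfl⟩
  exact indV_mem (fun g v => LinearMap.mem_range.2 ⟨Finsupp.single g v, by simp⟩) x

open scoped Classical in
/-- The restriction of the natural map `ind_H^G W → V` to the functions supported on `S⁻¹`. -/
def truncatedMap (ρ : Representation o G V) (H : Subgroup G) (W : Submodule o V)
    (hW : IsStable ρ H W) (S : Set G) (hS : ∀ h ∈ H, ∀ g, g * h ∈ S ↔ g ∈ S) :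
    Representation.IndV H.subtype (subRep ρ H W hW) →ₗ[o] V :=
  Representation.Coinvariants.lift _
    (TensorProduct.lift
      ((Finsupp.lsum o (fun g : G =>
          LinearMap.toSpanSingleton o (W →ₗ[o] V)
            (if g⁻¹ ∈ S then ρ g⁻¹ ∘ₗ W.subtype else 0))) ∘ₗ
        (MonoidAlgebra.coeffLinearEquiv o).toLinearMap))
    (by
      intro h
      ext g v
      have e : ((subRep ρ H W hW h v : W) : V) = ρ h v := rfl
      have e2 := hS h⁻¹ (inv_mem h.2) g⁻¹
      by_cases hg : g⁻¹ ∈ S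
      · simp [e, e2, hg]
      · simp [e2, hg])

open scoped Classical in
theorem truncatedMap_mk (ρ : Representation o G V) (H : Subgroup G) (W : Submodule o V)
    (hW : IsStable ρ H W) (S : Set G) (hS : ∀ h ∈ H, ∀ g, g * h ∈ S ↔ g ∈ S) (g : G) (w : W) :
    truncatedMap ρ H W hW S hS (Representation.IndV.mk H.subtype _ g w) =
      if g⁻¹ ∈ S then ρ g⁻¹ w else 0 := by
  by_cases hg : g⁻¹ ∈ S <;> simp [truncatedMap, hg]

theorem presentationMap_ind (ρ : Representation o G V) (H : Subgroup G) (W : Submodule o V)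
    (hW : IsStable ρ H W) (x : G) (r : Representation.IndV H.subtype (subRep ρ H W hW)) :
    presentationMap ρ H W hW (Representation.ind H.subtype (subRep ρ H W hW) x r) =
      ρ x (presentationMap ρ H W hW r) := by
  have : presentationMap ρ H W hW ∘ₗ Representation.ind H.subtype (subRep ρ H W hW) x =
      ρ x ∘ₗ presentationMap ρ H W hW := Representation.IndV.hom_ext _ _ fun g =>
    LinearMap.ext fun w => by
      simp only [LinearMap.comp_apply]
      rw [← LinearMap.comp_apply, ← LinearMap.comp_apply]
      change presentationMap ρ H W hW (Representation.ind _ _ x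
        (Representation.IndV.mk H.subtype _ g w)) = ρ x (presentationMap ρ H W hW
        (Representation.IndV.mk H.subtype _ g w))
      rw [Representation.ind_mk, presentationMap_mk, presentationMap_mk, ← Module.End.mul_apply,
        ← map_mul, mul_inv_rev, inv_inv]
  exact LinearMap.congr_fun this r

/-- A vector of the intersection is the image of some `f` on which truncation changes nothing, and
of some `f'` killed by truncation; `f - f'` is then a relation whose truncation is the given vector.
-/
theorem orbitSpan_inf_le_map_truncatedMap (ρ : Representation o G V) (H : Subgroup G)
    (W : Submodule o V) (hW : IsStable ρ H W) (S : Set G)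
    (hS : ∀ h ∈ H, ∀ g, g * h ∈ S ↔ g ∈ S) :
    orbitSpan ρ S W ⊓ orbitSpan ρ Sᶜ W ≤
      (LinearMap.ker (presentationMap ρ H W hW)).map (truncatedMap ρ H W hW S hS) := by
  set P := presentationMap ρ H W hW
  set θ := truncatedMap ρ H W hW S hS
  have h1 : orbitSpan ρ S W ≤ (LinearMap.eqLocus P θ).map P := by
    refine orbitSpan_le.2 fun s hs w hw => ⟨Representation.IndV.mk H.subtype _ s⁻¹ ⟨w, hw⟩, ?_, ?_⟩
    · change P _ = θ _
      rw [truncatedMap_mk, presentationMap_mk, inv_inv, if_pos hs]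
    · rw [presentationMap_mk, inv_inv]
  have h2 : orbitSpan ρ Sᶜ W ≤ (LinearMap.ker θ).map P := by
    refine orbitSpan_le.2 fun s hs w hw => ⟨Representation.IndV.mk H.subtype _ s⁻¹ ⟨w, hw⟩, ?_, ?_⟩
    · change θ _ = 0
      rw [truncatedMap_mk, inv_inv, if_neg hs]
    · rw [presentationMap_mk, inv_inv]
  rintro v ⟨hv1, hv2⟩
  obtain ⟨f, hf, hfv⟩ := h1 hv1
  obtain ⟨f', hf', hfv'⟩ := h2 hv2
  have hf : P f = θ f := hf
  have hf' : θ f' = 0 := hf'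
  refine ⟨f - f', ?_, ?_⟩
  · change P (f - f') = 0
    rw [map_sub, hfv, hfv', sub_self]
  · rw [map_sub, hf', ← hf, hfv, sub_zero]

/-- When all vertices of the translated relation are in `S`, its truncation is its image in `V`,
which is `0`; when none is, the truncation is `0` for lack of terms. Otherwise two vertices lie on
opposite sides, and the finite boundary `hT` leaves finitely many translates up to the finite
`H`-orbits. -/
theorem finite_truncatedMap_orbit (ρ : Representation o G V) (H : Subgroup G) (W : Submodule o V)
    (hW : IsStable ρ H W) (S : Set G) (hS : ∀ h ∈ H, ∀ g, g * h ∈ S ↔ g ∈ S)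
    (hT : ∀ g : G, ∃ T : Finset G, ∀ s ∈ S, s * g ∉ S → ∃ τ ∈ T, τ⁻¹ * (s * g) ∈ H)
    (hfin : ∀ r, ((fun h => Representation.ind H.subtype (subRep ρ H W hW) h r) '' H).Finite)
    {r : Representation.IndV H.subtype (subRep ρ H W hW)} (hr : presentationMap ρ H W hW r = 0) :
    (Set.range fun x => truncatedMap ρ H W hW S hS
      (Representation.ind H.subtype (subRep ρ H W hW) x r)).Finite := by
  classical
  choose T hT using hT
  obtain ⟨f, hf⟩ := exists_indV_eq_sum r
  set ι := Representation.ind H.subtype (subRep ρ H W hW)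
  set θ := truncatedMap ρ H W hW S hS
  refine ((Set.finite_singleton (0 : V)).union (f.support.finite_toSet.biUnion fun g _ =>
    f.support.finite_toSet.biUnion fun g' _ => (T (g * g'⁻¹)).finite_toSet.biUnion fun τ _ =>
      (hfin (ι g' r)).image fun x => θ (ι τ x))).subset ?_
  rintro _ ⟨x, rfl⟩
  have hP : presentationMap ρ H W hW (ι x r) = 0 := by rw [presentationMap_ind, hr, map_zero]
  have e1 : ι x r = ∑ g ∈ f.support, Representation.IndV.mk H.subtype _ (g * x⁻¹) (f g) := by
    conv_lhs => rw [hf]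
    rw [map_sum]
    exact Finset.sum_congr rfl fun g _ => Representation.ind_mk _ _ _ _ _
  have e2 : θ (ι x r) = ∑ g ∈ f.support, if x * g⁻¹ ∈ S then ρ (x * g⁻¹) (f g) else 0 := by
    rw [e1, map_sum]
    refine Finset.sum_congr rfl fun g _ => ?_
    rw [truncatedMap_mk, mul_inv_rev, inv_inv]
  have e3 : ∑ g ∈ f.support, ρ (x * g⁻¹) (f g) = 0 := by
    rw [← hP, e1, map_sum]
    refine Finset.sum_congr rfl fun g _ => ?_
    rw [presentationMap_mk, mul_inv_rev, inv_inv]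
  by_cases h1 : ∀ g ∈ f.support, x * g⁻¹ ∈ S
  · left
    change θ (ι x r) = 0
    rw [e2, ← e3]
    exact Finset.sum_congr rfl fun g hg => if_pos (h1 g hg)
  by_cases h2 : ∀ g ∈ f.support, x * g⁻¹ ∉ S
  · left
    change θ (ι x r) = 0
    rw [e2]
    exact Finset.sum_eq_zero fun g hg => if_neg (h2 g hg)
  push Not at h1 h2
  obtain ⟨g', hg', hx'⟩ := h1
  obtain ⟨g, hg, hx⟩ := h2
  right
  -- Here `x * g⁻¹ ∈ S` and `x * g'⁻¹ ∉ S`, so `x = τ * h * g'` with `h ∈ H` and `τ` in a finite set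
  -- depending only on `g` and `g'`.
  obtain ⟨τ, hτ, hh⟩ := hT (g * g'⁻¹) _ hx (by simpa [mul_assoc] using hx')
  simp only [Set.mem_iUnion]
  refine ⟨g, hg, g', hg', τ, hτ, _, ⟨_, hh, rfl⟩, ?_⟩
  change θ (ι τ (ι _ (ι g' r))) = θ (ι x r)
  rw [← Module.End.mul_apply, ← Module.End.mul_apply, ← map_mul, ← map_mul]
  congr 3
  group

end Induced

/-! ### Finiteness of `Δ(Y)` and of the `U₀`-invariants -/

section Delta

variable {F : Type*} [Field F] [ValuativeRel F] [TopologicalSpace F] [IsNonarchimedeanLocalField F]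
variable {o V : Type*} [CommRing o] [AddCommGroup V] [Module o V]

theorem finite_image_sup_centre {σ : Representation o (GL (Fin 2) F) V} (hσ : IsSmooth σ)
    (hZ : ∀ v, ((fun z => σ z v) '' centre F).Finite) (v : V) :
    ((fun g => σ g v) '' (maxCompact F ⊔ centre F : Subgroup (GL (Fin 2) F))).Finite := by
  refine ((hZ v).biUnion fun x _ => finite_image_of_isCompact hσ
    (isCompact_maxCompact (F := F)) x).subset ?_
  rintro _ ⟨g, hg, rfl⟩
  obtain ⟨k, hk, z, hz, rfl⟩ := mem_sup_centre_iff.1 hg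
  simp only [Set.mem_iUnion]
  refine ⟨σ z v, ⟨z, hz, rfl⟩, k, hk, ?_⟩
  change σ k (σ z v) = σ (k * z) v
  rw [← Module.End.mul_apply, ← map_mul]

variable {ρ : Representation o (GL (Fin 2) F) V}

theorem finite_invariants (hadm : IsAdmissible ρ)
    (hFG : ∀ N : Submodule o V, N.FG → (N : Set V).Finite) (H : Subgroup (GL (Fin 2) F))
    (hHo : IsOpen (H : Set (GL (Fin 2) F))) (hHc : IsCompact (H : Set (GL (Fin 2) F))) :
    {v | ∀ h ∈ H, ρ h v = v}.Finite := by
  refine (hFG _ (hadm H hHo hHc)).subset fun v hv => ?_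
  rw [SetLike.mem_coe, Representation.mem_invariants]
  exact fun h => hv h h.2

/-- A central translate of `v` is fixed by the same compact open subgroup as `v`, whose invariants
are finite. No central character is needed. -/
theorem finite_image_centre (hρ : IsSmooth ρ) (hadm : IsAdmissible ρ)
    (hFG : ∀ N : Submodule o V, N.FG → (N : Set V).Finite) (v : V) :
    ((fun z => ρ z v) '' centre F).Finite := by
  obtain ⟨H, hH⟩ := hρ v
  let J : Subgroup (GL (Fin 2) F) := maxCompact F ⊓ H.toSubgroup
  have hJo : IsOpen (J : Set (GL (Fin 2) F)) := isOpen_maxCompact.inter H.isOpen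
  have hJc : IsCompact (J : Set (GL (Fin 2) F)) :=
    isCompact_maxCompact.of_isClosed_subset (Subgroup.isClosed_of_isOpen _ hJo) fun _ h => h.1
  refine (finite_invariants hadm hFG J hJo hJc).subset ?_
  rintro _ ⟨z, hz, rfl⟩ h hh
  change ρ h (ρ z v) = ρ z v
  rw [← Module.End.mul_apply, ← map_mul, Subgroup.mem_center_iff.1 hz h, map_mul,
    Module.End.mul_apply, hH h hh.2]

theorem finite_of_isFGUnder (hρ : IsSmooth ρ) (hadm : IsAdmissible ρ)
    (hFG : ∀ N : Submodule o V, N.FG → (N : Set V).Finite) {H : Subgroup (GL (Fin 2) F)}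
    (hH : H ≤ maxCompact F ⊔ centre F) {W : Submodule o V} (hW : IsFGUnder ρ H W) :
    (W : Set V).Finite := by
  obtain ⟨-, X, -, rfl⟩ := hW
  refine hFG _ (Submodule.fg_span ?_)
  refine (X.finite_toSet.biUnion fun x _ => finite_image_sup_centre hρ
    (finite_image_centre hρ hadm hFG) x).subset ?_
  rintro _ ⟨h, hh, x, hx, rfl⟩
  simp only [Set.mem_iUnion]
  exact ⟨x, hx, h, hH hh, rfl⟩

/-- A central `z` sends `[g, w]` to `[g, z w]`, and `W` is finite; smoothness of the induced
representation takes care of `K`. -/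
theorem finite_image_ind (hρ : IsSmooth ρ) {W : Submodule o V} (hWfin : (W : Set V).Finite)
    (hW : IsStable ρ (maxCompact F ⊔ centre F : Subgroup (GL (Fin 2) F)) W)
    (r : Representation.IndV (maxCompact F ⊔ centre F).subtype (subRep ρ _ W hW)) :
    ((fun h => Representation.ind (maxCompact F ⊔ centre F).subtype (subRep ρ _ W hW) h r) ''
      (maxCompact F ⊔ centre F : Subgroup (GL (Fin 2) F))).Finite := by
  refine finite_image_sup_centre (isSmooth_ind hρ isOpen_maxCompact le_sup_left W hW)
    (fun v => ?_) r
  suffices h : v ∈ orbitFiniteVectors (Representation.ind (maxCompact F ⊔ centre F).subtype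
    (subRep ρ _ W hW)) (centre F : Set (GL (Fin 2) F)) from h
  refine indV_mem (fun g w => ?_) v
  have : Finite W := hWfin
  refine (Set.finite_range fun w : W => Representation.IndV.mk (maxCompact F ⊔ centre F).subtype
    (subRep ρ _ W hW) g w).subset ?_
  rintro _ ⟨z, hz, rfl⟩
  have hz' : z ∈ maxCompact F ⊔ centre F := (le_sup_right : centre F ≤ _) hz
  refine ⟨subRep ρ _ W hW ⟨z, hz'⟩ w, ?_⟩
  change _ = Representation.ind _ _ z (Representation.IndV.mk _ _ g w)
  rw [Representation.ind_mk, ← indV_mk_mul (subRep ρ _ W hW) ⟨z, hz'⟩ (g * z⁻¹) w]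
  have e : z * (g * z⁻¹) = g := by
    rw [← mul_assoc, ← Subgroup.mem_center_iff.1 hz g, mul_inv_cancel_right]
  change _ = Representation.IndV.mk _ _ (z * (g * z⁻¹)) _
  rw [e]

theorem finite_halfTree_inf (hρ : IsSmooth ρ)
    (hFG : ∀ N : Submodule o V, N.FG → (N : Set V).Finite) {W : Submodule o V}
    (hWfin : (W : Set V).Finite)
    (hW : IsStable ρ (maxCompact F ⊔ centre F : Subgroup (GL (Fin 2) F)) W)
    (hker : IsFGUnder (Representation.ind (maxCompact F ⊔ centre F).subtype (subRep ρ _ W hW))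
      Set.univ (LinearMap.ker (presentationMap ρ _ W hW))) :
    ((orbitSpan ρ (halfTree F) W ⊓ orbitSpan ρ (halfTree F)ᶜ W : Submodule o V) :
      Set V).Finite := by
  have hS : ∀ h ∈ maxCompact F ⊔ centre F, ∀ g, g * h ∈ halfTree F ↔ g ∈ halfTree F :=
    fun h hh g => mul_mem_halfTree_iff hh
  refine Set.Finite.subset ?_ (orbitSpan_inf_le_map_truncatedMap ρ _ W hW (halfTree F) hS)
  refine hFG _ ?_
  obtain ⟨-, X, hX, e⟩ := hker
  rw [e, orbitSpan, Submodule.map_span]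
  refine Submodule.fg_span ?_
  refine (X.finite_toSet.biUnion fun r hr => finite_truncatedMap_orbit ρ _ W hW (halfTree F) hS
    exists_finset_halfTree (finite_image_ind hρ hWfin hW) (hX hr)).subset ?_
  rintro _ ⟨_, ⟨g, -, r, hr, rfl⟩, rfl⟩
  simp only [Set.mem_iUnion]
  exact ⟨r, hr, g, rfl⟩

/-- For fixed `a, a' ∈ A`, the vectors in `(P + a) ∩ (Q + a')` form a coset of `P ∩ Q` or the empty
set. -/
theorem finite_sup_inf_sup {P Q A : Submodule o V} (hPQ : ((P ⊓ Q : Submodule o V) : Set V).Finite)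
    (hA : (A : Set V).Finite) : (((P ⊔ A) ⊓ (Q ⊔ A) : Submodule o V) : Set V).Finite := by
  have key : ∀ a a' : V, {v | v - a ∈ P ∧ v - a' ∈ Q}.Finite := by
    intro a a'
    rcases Set.eq_empty_or_nonempty {v | v - a ∈ P ∧ v - a' ∈ Q} with h | ⟨v₀, h1, h2⟩
    · rw [h]
      exact Set.finite_empty
    · refine (hPQ.image (· + v₀)).subset fun v hv => ⟨v - v₀, ⟨?_, ?_⟩, sub_add_cancel _ _⟩
      · simpa using sub_mem hv.1 h1
      · simpa using sub_mem hv.2 h2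
  refine (hA.biUnion fun a _ => hA.biUnion fun a' _ => key a a').subset ?_
  rintro v ⟨hv1, hv2⟩
  obtain ⟨p, hp, a, ha, rfl⟩ := Submodule.mem_sup.1 hv1
  obtain ⟨q, hq, a', ha', e⟩ := Submodule.mem_sup.1 hv2
  simp only [Set.mem_iUnion]
  exact ⟨a, ha, a', ha', by simpa using hp, by simpa [← e] using hq⟩

/-- For `y = g w`, the elements `b` and `b * g` lie on the same side of the half-tree except near
its boundary. The exceptional vectors `b y` form a finite set, which goes into `A`. -/
theorem exists_finite_orbitSpan_sup (hρ : IsSmooth ρ) (hadm : IsAdmissible ρ)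
    (hFG : ∀ N : Submodule o V, N.FG → (N : Set V).Finite) {W : Submodule o V}
    (hWfin : (W : Set V).Finite) (ϖ : IntegerRing F) (hϖ : Irreducible ϖ) {y : V}
    (hW : IsStable ρ (maxCompact F ⊔ centre F : Subgroup (GL (Fin 2) F)) W)
    (hy : y ∈ orbitSpan ρ Set.univ W) : ∃ A : Set V, A.Finite ∧
      (∀ b ∈ borelPlus ϖ hϖ, ρ b y ∈ orbitSpan ρ (halfTree F) W ⊔ Submodule.span o A) ∧
      (∀ b ∈ (borel F : Set (GL (Fin 2) F)) \ borelPlus ϖ hϖ,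
        ρ b y ∈ orbitSpan ρ (halfTree F)ᶜ W ⊔ Submodule.span o A) := by
  unfold orbitSpan at hy
  induction hy using Submodule.span_induction with
  | mem x hx =>
    obtain ⟨g, -, w, hw, rfl⟩ := hx
    obtain ⟨T, hT⟩ := exists_finset_halfTree g
    obtain ⟨T', hT'⟩ := exists_finset_halfTree g⁻¹
    have horb := finite_image_sup_centre hρ (finite_image_centre hρ hadm hFG) (ρ g w)
    -- `T` handles `b` inside and `b * g` outside, where `b * g ∈ τ KZ`; `T'` handles the opposite
    -- crossing, where `b ∈ τ KZ` and the `KZ`-orbit of `g w` enters.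
    refine ⟨(⋃ τ ∈ T, (ρ τ) '' W) ∪ ⋃ τ ∈ T', (ρ τ) '' ((fun h => ρ h (ρ g w)) ''
      (maxCompact F ⊔ centre F : Subgroup (GL (Fin 2) F))),
      (T.finite_toSet.biUnion fun τ _ => hWfin.image _).union
        (T'.finite_toSet.biUnion fun τ _ => horb.image _), fun b hb => ?_, fun b hb => ?_⟩
    · by_cases hbg : b * g ∈ halfTree F
      · refine Submodule.mem_sup_left ?_
        change ρ b (ρ g w) ∈ _
        rw [← Module.End.mul_apply, ← map_mul]
        exact apply_mem_orbitSpan ρ hbg hw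
      · obtain ⟨τ, hτ, h⟩ := hT b (borelPlus_subset_halfTree ϖ hϖ hb) hbg
        refine Submodule.mem_sup_right (Submodule.subset_span (Or.inl ?_))
        simp only [Set.mem_iUnion]
        refine ⟨τ, hτ, ρ (τ⁻¹ * (b * g)) w, hW _ h _ hw, ?_⟩
        rw [← Module.End.mul_apply, ← map_mul, mul_inv_cancel_left, map_mul,
          Module.End.mul_apply]
    · have hb' : b ∉ halfTree F := fun h =>
        hb.2 ((mem_borelPlus_iff_mem_halfTree ϖ hϖ hb.1).2 h)
      by_cases hbg : b * g ∈ halfTree F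
      · obtain ⟨τ, hτ, h⟩ := hT' (b * g) hbg (by simpa using hb')
        rw [mul_inv_cancel_right] at h
        refine Submodule.mem_sup_right (Submodule.subset_span (Or.inr ?_))
        simp only [Set.mem_iUnion]
        refine ⟨τ, hτ, _, ⟨τ⁻¹ * b, h, rfl⟩, ?_⟩
        change ρ τ (ρ (τ⁻¹ * b) (ρ g w)) = ρ b (ρ g w)
        rw [← Module.End.mul_apply (ρ τ), ← map_mul, mul_inv_cancel_left]
      · refine Submodule.mem_sup_left ?_
        change ρ b (ρ g w) ∈ _
        rw [← Module.End.mul_apply, ← map_mul]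
        exact apply_mem_orbitSpan ρ hbg hw
  | zero => exact ⟨∅, Set.finite_empty, fun b _ => by simp, fun b _ => by simp⟩
  | add x y _ _ hx hy =>
    obtain ⟨A, hA, h1, h2⟩ := hx
    obtain ⟨A', hA', h1', h2'⟩ := hy
    have l1 : Submodule.span o A ≤ Submodule.span o (A ∪ A') :=
      Submodule.span_mono Set.subset_union_left
    have l2 : Submodule.span o A' ≤ Submodule.span o (A ∪ A') :=
      Submodule.span_mono Set.subset_union_right
    refine ⟨A ∪ A', hA.union hA', fun b hb => ?_, fun b hb => ?_⟩
    · rw [map_add]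
      exact add_mem (sup_le_sup_left l1 _ (h1 b hb)) (sup_le_sup_left l2 _ (h1' b hb))
    · rw [map_add]
      exact add_mem (sup_le_sup_left l1 _ (h2 b hb)) (sup_le_sup_left l2 _ (h2' b hb))
  | smul a x _ hx =>
    obtain ⟨A, hA, h1, h2⟩ := hx
    refine ⟨A, hA, fun b hb => ?_, fun b hb => ?_⟩
    · rw [map_smul]
      exact Submodule.smul_mem _ _ (h1 b hb)
    · rw [map_smul]
      exact Submodule.smul_mem _ _ (h2 b hb)

theorem orbitSpan_univ_eq_top {H : Subgroup (GL (Fin 2) F)} {W : Submodule o V}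
    {hW : IsStable ρ H W} (hsurj : Function.Surjective (presentationMap ρ H W hW)) :
    orbitSpan ρ Set.univ W = ⊤ := by
  rw [eq_top_iff]
  intro v _
  obtain ⟨x, rfl⟩ := hsurj v
  suffices h : x ∈ (orbitSpan ρ Set.univ W).comap (presentationMap ρ H W hW) from h
  refine indV_mem (fun g w => ?_) x
  rw [Submodule.mem_comap, presentationMap_mk]
  exact apply_mem_orbitSpan ρ (Set.mem_univ _) w.2

theorem finite_borelPlus_inf_diff (hρ : IsSmooth ρ) (hadm : IsAdmissible ρ)
    (hFG : ∀ N : Submodule o V, N.FG → (N : Set V).Finite)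
    (hpres : IsFinitelyPresented ρ (maxCompact F ⊔ centre F)) (ϖ : IntegerRing F)
    (hϖ : Irreducible ϖ) {Y : Set V} (hY : Y.Finite) :
    ((orbitSpan ρ (borelPlus ϖ hϖ) Y ⊓
      orbitSpan ρ ((borel F : Set (GL (Fin 2) F)) \ borelPlus ϖ hϖ) Y : Submodule o V) :
        Set V).Finite := by
  obtain ⟨W, hW, hWFG, hsurj, hker⟩ := hpres
  have hWfin := finite_of_isFGUnder hρ hadm hFG le_rfl hWFG
  have hgen := orbitSpan_univ_eq_top hsurj
  choose A hA h1 h2 using fun y : V =>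
    exists_finite_orbitSpan_sup hρ hadm hFG hWfin ϖ hϖ (y := y) hW (hgen ▸ Submodule.mem_top)
  have hle : ∀ y ∈ Y, Submodule.span o (A y) ≤ Submodule.span o (⋃ y ∈ Y, A y) := fun y hy =>
    Submodule.span_mono (Set.subset_biUnion_of_mem hy)
  refine (finite_sup_inf_sup (finite_halfTree_inf hρ hFG hWfin hW hker)
    (hFG _ (Submodule.fg_span (hY.biUnion fun y _ => hA y)))).subset (inf_le_inf ?_ ?_)
  · exact orbitSpan_le.2 fun b hb y hy => sup_le_sup_left (hle y hy) _ (h1 y b hb)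
  · exact orbitSpan_le.2 fun b hb y hy => sup_le_sup_left (hle y hy) _ (h2 y b hb)

/-- By the Iwasawa decomposition `G = B KZ`, the `KZ`-stability of `W` absorbs the second factor. -/
theorem orbitSpan_borel_eq_top {W : Submodule o V}
    (hW : IsStable ρ (maxCompact F ⊔ centre F : Subgroup (GL (Fin 2) F)) W)
    (hgen : orbitSpan ρ Set.univ W = ⊤) : orbitSpan ρ (borel F) W = ⊤ := by
  rw [eq_top_iff, ← hgen]
  refine orbitSpan_le.2 fun g _ w hw => ?_
  obtain ⟨b, z, k, hz, hk, rfl, hb, -⟩ := exists_iwasawa g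
  rw [mul_assoc, map_mul, Module.End.mul_apply]
  refine apply_mem_orbitSpan ρ hb (hW _ ?_ _ hw)
  exact mul_mem ((le_sup_right : centre F ≤ _) hz) ((le_sup_left : maxCompact F ≤ _) hk)

theorem finite_unipotentInt_invariants (hρ : IsSmooth ρ) (hadm : IsAdmissible ρ)
    (hFG : ∀ N : Submodule o V, N.FG → (N : Set V).Finite)
    (hpres : IsFinitelyPresented ρ (maxCompact F ⊔ centre F)) (ϖ : IntegerRing F)
    (hϖ : Irreducible ϖ) {X : Set V} (hX : X.Finite) :
    {m : V | m ∈ orbitSpan ρ (borelPlus ϖ hϖ) X ∧ ∀ u ∈ unipotentInt F, ρ u m = m}.Finite := by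
  obtain ⟨W, hW, hWFG, hsurj, -⟩ := id hpres
  have hWfin := finite_of_isFGUnder hρ hadm hFG le_rfl hWFG
  have hgen := orbitSpan_borel_eq_top hW (orbitSpan_univ_eq_top hsurj)
  -- `X` alone need not generate `V` over `B`; adjoining `W` ensures this and only enlarges `⟨B⁺X⟩`.
  have hgen' : orbitSpan ρ (borel F) (X ∪ W) = ⊤ := by
    rw [eq_top_iff, ← hgen]
    exact orbitSpan_mono ρ le_rfl Set.subset_union_right
  refine (finite_borelPlus_inf_diff hρ hadm hFG hpres ϖ hϖ (hX.union hWfin)).subset ?_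
  rintro v ⟨hv, hinv⟩
  have hv' := orbitSpan_mono ρ (le_refl (borelPlus ϖ hϖ)) (X' := X ∪ W) Set.subset_union_left hv
  exact ⟨hv', mem_orbitSpan_diff_of_invariant ϖ hϖ hρ (finite_invariants hadm hFG) hgen' hv' hinv⟩

end Delta

/-! ### The coefficient ring `o` and the dualizing module `L/o` -/

section Coefficients

variable {p : ℕ} [Fact p.Prime] {o : Type*} [CommRing o] [IsDomain o] [Algebra ℤ_[p] o]
  [Module.Finite ℤ_[p] o]

section Torsion

variable {V : Type*} [AddCommGroup V] [Module o V]

variable (p) in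
-- By integrality, a nonzero ideal of `o` meets `ℤ_[p]` in a nonzero ideal, which is generated by a
-- power of `p`.
theorem exists_pow_eq_mul {a : o} (ha : a ≠ 0) : ∃ (n : ℕ) (b : o), (p : o) ^ n = a * b := by
  have h := Ideal.comap_ne_bot_of_integral_mem (R := ℤ_[p]) ha (Ideal.mem_span_singleton_self a)
    (Algebra.IsIntegral.isIntegral a)
  obtain ⟨n, hn⟩ := PadicInt.ideal_eq_span_pow_p h
  have hmem : (p : ℤ_[p]) ^ n ∈ (Ideal.span {a}).comap (algebraMap ℤ_[p] o) :=
    hn ▸ Ideal.mem_span_singleton_self _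
  rw [Ideal.mem_comap, Ideal.mem_span_singleton, map_pow, map_natCast] at hmem
  exact ⟨n, hmem⟩

variable (p) in
theorem exists_pow_smul_eq_zero (htors : Module.IsTorsion o V) (v : V) :
    ∃ n : ℕ, (p : o) ^ n • v = 0 := by
  obtain ⟨⟨a, ha⟩, hav⟩ := @htors v
  obtain ⟨n, b, hb⟩ := exists_pow_eq_mul p (nonZeroDivisors.ne_zero ha)
  refine ⟨n, ?_⟩
  rw [hb, mul_comm, mul_smul]
  exact (congrArg (b • ·) hav).trans (smul_zero b)

variable [Module.Free ℤ_[p] o]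

variable (p o) in
theorem natCast_ne_zero : (p : o) ≠ 0 := by
  have := FaithfulSMul.algebraMap_injective ℤ_[p] o
  rw [← map_natCast (algebraMap ℤ_[p] o), ne_eq, map_eq_zero_iff _ this]
  exact_mod_cast (Fact.out : p.Prime).ne_zero

variable (p o) in
theorem not_isUnit_natCast : ¬ IsUnit (p : o) := by
  rw [← map_natCast (algebraMap ℤ_[p] o)]
  intro h
  exact PadicInt.p_nonunit (isUnit_of_map_unit _ _ h)

variable (p) in
include p in
-- A cyclic torsion module is killed by some `p ^ n`, so coordinates over `ℤ_[p]` matter only modulo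
-- `p ^ n`.
theorem finite_of_fg (htors : Module.IsTorsion o V) (N : Submodule o V) (hN : N.FG) :
    (N : Set V).Finite := by
  induction N, hN using Submodule.fg_induction with
  | singleton x =>
    obtain ⟨n, hn⟩ := exists_pow_smul_eq_zero p htors x
    let b := Module.Free.chooseBasis ℤ_[p] o
    refine (Set.finite_range fun k : Module.Free.ChooseBasisIndex ℤ_[p] o → Fin (p ^ n) =>
      (∑ i, ((k i : ℕ) : ℤ_[p]) • b i) • x).subset ?_
    intro y hy
    obtain ⟨a, rfl⟩ := Submodule.mem_span_singleton.1 hy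
    refine ⟨fun i => ⟨(b.repr a i).appr n, PadicInt.appr_lt _ _⟩, ?_⟩
    have h : ∀ i, ∃ d : ℤ_[p],
        b.repr a i = (((b.repr a i).appr n : ℕ) : ℤ_[p]) + (p : ℤ_[p]) ^ n * d := by
      intro i
      obtain ⟨d, hd⟩ := Ideal.mem_span_singleton.1 (PadicInt.appr_spec n (b.repr a i))
      exact ⟨d, by rw [← hd]; ring⟩
    choose d hd using h
    have e : a = ∑ i, (((b.repr a i).appr n : ℕ) : ℤ_[p]) • b i +
        (∑ i, d i • b i) * (p : o) ^ n := by
      conv_lhs => rw [← b.sum_repr a]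
      rw [Finset.sum_mul, ← Finset.sum_add_distrib]
      refine Finset.sum_congr rfl fun i _ => ?_
      conv_lhs => rw [hd i]
      simp only [Algebra.smul_def, map_add, map_mul, map_pow, map_natCast]
      ring
    conv_rhs => rw [e, add_smul, mul_smul, hn, smul_zero, add_zero]
  | sup N₁ N₂ _ _ h₁ h₂ =>
    refine (h₁.image2 (· + ·) h₂).subset fun v hv => ?_
    obtain ⟨a, ha, b, hb, rfl⟩ := Submodule.mem_sup.1 hv
    exact ⟨a, ha, b, hb, rfl⟩

end Torsion

section Dualizing

variable [Module.Free ℤ_[p] o]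

variable (p) in
-- This is the `p`-adic completeness of `o`, obtained coordinatewise from that of `ℤ_[p]`.
theorem exists_limit (c : ℕ → o) (hc : ∀ n, (p : o) ^ n ∣ c (n + 1) - c n) :
    ∃ a : o, ∀ n, (p : o) ^ n ∣ a - c n := by
  let b := Module.Free.chooseBasis ℤ_[p] o
  have hdiv : ∀ (n : ℕ) (x : o), (p : o) ^ n ∣ x ↔ ∀ i, (p : ℤ_[p]) ^ n ∣ b.repr x i := by
    intro n x
    constructor
    · rintro ⟨y, rfl⟩ i
      refine ⟨b.repr y i, ?_⟩
      have e : (p : o) ^ n * y = (p : ℤ_[p]) ^ n • y := by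
        rw [Algebra.smul_def, map_pow, map_natCast]
      rw [e]
      simp
    · intro h
      choose d hd using h
      refine ⟨∑ i, d i • b i, ?_⟩
      have e : (p : o) ^ n * ∑ i, d i • b i = (p : ℤ_[p]) ^ n • ∑ i, d i • b i := by
        rw [Algebra.smul_def ((p : ℤ_[p]) ^ n), map_pow, map_natCast]
      rw [e, Finset.smul_sum]
      conv_lhs => rw [← b.sum_repr x]
      exact Finset.sum_congr rfl fun i _ => by rw [hd i, mul_smul]
  have hlim : ∀ i, ∃ L : ℤ_[p], ∀ n, (p : ℤ_[p]) ^ n ∣ L - b.repr (c n) i := by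
    intro i
    have hmem : ∀ (n : ℕ) (x y : ℤ_[p]), x ≡ y [SMOD (IsLocalRing.maximalIdeal ℤ_[p] ^ n •
        (⊤ : Submodule ℤ_[p] ℤ_[p]))] ↔ (p : ℤ_[p]) ^ n ∣ x - y := by
      intro n x y
      rw [SModEq.sub_mem, smul_eq_mul, Ideal.mul_top, PadicInt.maximalIdeal_eq_span_p,
        Ideal.span_singleton_pow, Ideal.mem_span_singleton]
    obtain ⟨L, hL⟩ := IsPrecomplete.prec
      (inferInstance : IsPrecomplete (IsLocalRing.maximalIdeal ℤ_[p]) ℤ_[p])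
      (f := fun n => b.repr (c n) i) (by
        intro m n hmn
        rw [hmem]
        induction n, hmn using Nat.le_induction with
        | base => simp
        | succ n hmn ih =>
          have h1 := ((hdiv n _).1 (hc n) i)
          rw [map_sub, Finsupp.sub_apply] at h1
          have h2 := dvd_sub ih ((pow_dvd_pow (p : ℤ_[p]) hmn).trans h1)
          rwa [sub_sub, add_sub_cancel] at h2)
    exact ⟨L, fun n => (hmem n _ _).1 (hL n).symm⟩
  choose L hL using hlim
  refine ⟨∑ i, L i • b i, fun n => (hdiv n _).2 fun i => ?_⟩
  rw [map_sub, Finsupp.sub_apply, b.repr_sum_self]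
  exact hL i n

variable {L : Type*} [Field L] [Algebra o L] [IsFractionRing o L]

variable (o L) in
/-- The module `L/o`. -/
abbrev Dualizing : Type _ := L ⧸ LinearMap.range (Algebra.linearMap o L)

theorem dualizing_mk_eq_zero {x : L} :
    (Submodule.Quotient.mk x : Dualizing o L) = 0 ↔ ∃ a : o, algebraMap o L a = x := by
  rw [Submodule.Quotient.mk_eq_zero]
  rfl

variable (p o) in
theorem exists_eq_div_pow (x : L) :
    ∃ (n : ℕ) (c : o), x = algebraMap o L c / algebraMap o L ((p : o) ^ n) := by
  obtain ⟨a, b, hb, rfl⟩ := IsFractionRing.div_surjective (A := o) x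
  obtain ⟨n, d, hd⟩ := exists_pow_eq_mul p (nonZeroDivisors.ne_zero hb)
  refine ⟨n, a * d, ?_⟩
  have hb0 : algebraMap o L b ≠ 0 := by
    simpa using nonZeroDivisors.ne_zero hb
  have hd0 : d ≠ 0 := by
    rintro rfl
    rw [mul_zero] at hd
    exact pow_ne_zero n (natCast_ne_zero p o) hd
  have hd0 : algebraMap o L d ≠ 0 := by simpa using hd0
  rw [hd, map_mul, map_mul, mul_div_mul_right _ _ hd0]

variable (p) in
include p in
-- `L/o` is generated by the classes of `p⁻ⁿ`. The image of such a class is killed by `p ^ n`, hence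
-- equals `cₙ p⁻ⁿ`; the `cₙ` are compatible and converge to the scalar `a`.
theorem exists_end_eq_smul (f : Dualizing o L →ₗ[o] Dualizing o L) :
    ∃ a : o, ∀ x, f x = a • x := by
  set P : ℕ → L := fun n => algebraMap o L ((p : o) ^ n) with hP
  have hP0 : ∀ n, P n ≠ 0 := fun n => by
    exact (map_ne_zero_iff _ (FaithfulSMul.algebraMap_injective o L)).2
      (pow_ne_zero n (natCast_ne_zero p o))
  have hp0 : algebraMap o L p ≠ 0 :=
    (map_ne_zero_iff _ (FaithfulSMul.algebraMap_injective o L)).2 (natCast_ne_zero p o)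
  have hPs : ∀ n, P (n + 1) = algebraMap o L p * P n := fun n => by
    simp [hP, pow_succ, mul_comm]
  have h : ∀ n, ∃ c : o, f (Submodule.Quotient.mk (P n)⁻¹) =
      Submodule.Quotient.mk (algebraMap o L c * (P n)⁻¹) := by
    intro n
    obtain ⟨y, hy⟩ := Submodule.Quotient.mk_surjective _ (f (Submodule.Quotient.mk (P n)⁻¹))
    have h1 : (p : o) ^ n • f (Submodule.Quotient.mk (P n)⁻¹) = 0 := by
      rw [← map_smul, ← Submodule.Quotient.mk_smul, Algebra.smul_def]
      change f (Submodule.Quotient.mk (P n * (P n)⁻¹)) = 0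
      rw [mul_inv_cancel₀ (hP0 n), dualizing_mk_eq_zero.2 ⟨1, map_one _⟩, map_zero]
    rw [← hy, ← Submodule.Quotient.mk_smul, dualizing_mk_eq_zero] at h1
    obtain ⟨c, hc⟩ := h1
    refine ⟨c, ?_⟩
    rw [← hy, hc, Algebra.smul_def]
    change _ = Submodule.Quotient.mk (P n * y * (P n)⁻¹)
    rw [mul_comm (P n), mul_assoc, mul_inv_cancel₀ (hP0 n), mul_one]
  choose c hc using h
  have hcong : ∀ n, (p : o) ^ n ∣ c (n + 1) - c n := by
    intro n
    have h1 : (p : o) • f (Submodule.Quotient.mk (P (n + 1))⁻¹) =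
        f (Submodule.Quotient.mk (P n)⁻¹) := by
      rw [← map_smul, ← Submodule.Quotient.mk_smul, Algebra.smul_def, hPs, mul_inv,
        mul_inv_cancel_left₀ hp0]
    rw [hc, hc, ← Submodule.Quotient.mk_smul, ← sub_eq_zero, ← Submodule.Quotient.mk_sub,
      dualizing_mk_eq_zero] at h1
    obtain ⟨d, hd⟩ := h1
    refine ⟨d, FaithfulSMul.algebraMap_injective o L ?_⟩
    rw [map_mul, hd, Algebra.smul_def, hPs, map_sub]
    change _ = P n * _
    have := hP0 n
    field_simp
  obtain ⟨a, ha⟩ := exists_limit p c hcong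
  refine ⟨a, fun x => ?_⟩
  obtain ⟨y, rfl⟩ := Submodule.Quotient.mk_surjective _ x
  obtain ⟨n, d, rfl⟩ := exists_eq_div_pow p o y
  obtain ⟨e, he⟩ := ha n
  have e1 : algebraMap o L d / algebraMap o L ((p : o) ^ n) = d • (P n)⁻¹ := by
    rw [Algebra.smul_def, div_eq_mul_inv]
  rw [e1, Submodule.Quotient.mk_smul, map_smul, hc, ← sub_eq_zero, smul_comm, ← smul_sub,
    ← Submodule.Quotient.mk_smul, ← Submodule.Quotient.mk_sub, dualizing_mk_eq_zero.2 ⟨-e, ?_⟩,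
    smul_zero]
  rw [Algebra.smul_def, ← sub_mul, ← map_sub, ← neg_sub a, he, map_neg, map_neg, map_mul]
  change _ = -(P n * _) * _
  have := hP0 n
  field_simp

variable (p) in
include p in
theorem eq_zero_of_smul_dualizing {a : o} (ha : ∀ x : Dualizing o L, a • x = 0) : a = 0 := by
  by_contra h
  have h0 : algebraMap o L a ≠ 0 := by simpa using h
  have hp0 : algebraMap o L p ≠ 0 :=
    (map_ne_zero_iff _ (FaithfulSMul.algebraMap_injective o L)).2 (natCast_ne_zero p o)
  -- Multiplication by `a` sends this class to that of `p⁻¹`, which is nonzero because `p` is not a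
  -- unit.
  have h1 := ha (Submodule.Quotient.mk ((algebraMap o L a)⁻¹ * (algebraMap o L p)⁻¹))
  rw [← Submodule.Quotient.mk_smul, Algebra.smul_def, mul_inv_cancel_left₀ h0,
    dualizing_mk_eq_zero] at h1
  obtain ⟨b, hb⟩ := h1
  refine not_isUnit_natCast p o (IsUnit.of_mul_eq_one b (FaithfulSMul.algebraMap_injective o L ?_))
  rw [map_mul, hb, mul_inv_cancel₀ hp0, map_one]

/-- Ideals of `o` are principal and `L/o` is divisible, so Baer's criterion reduces to dividing one
element by a generator. -/
theorem baer_dualizing [IsPrincipalIdealRing o] : Module.Baer o (Dualizing o L) := by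
  intro I g
  obtain ⟨m, rfl⟩ := IsPrincipalIdealRing.principal I
  by_cases h0 : m = 0
  · refine ⟨0, fun n hn => ?_⟩
    have : n = 0 := by simpa [h0] using hn
    subst this
    exact (map_zero g).symm
  · obtain ⟨y, hy⟩ := Submodule.Quotient.mk_surjective _
      (g ⟨m, Submodule.subset_span (Set.mem_singleton _)⟩)
    have hm : algebraMap o L m ≠ 0 := by simpa using h0
    refine ⟨LinearMap.toSpanSingleton o _ (Submodule.Quotient.mk ((algebraMap o L m)⁻¹ * y)),
      fun n hn => ?_⟩
    obtain ⟨n, rfl⟩ := Submodule.mem_span_singleton.1 hn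
    rw [LinearMap.toSpanSingleton_apply, smul_assoc, ← Submodule.Quotient.mk_smul (r := m),
      Algebra.smul_def, mul_inv_cancel_left₀ hm, hy, ← map_smul]
    rfl

/-- The annihilator of `d` is generated by some `a` that is neither zero nor a unit; sending `d` to
the nonzero class of `a⁻¹` extends to `D` by injectivity. -/
theorem exists_dual_ne_zero [IsPrincipalIdealRing o] {D : Type*} [AddCommGroup D] [Module o D]
    (htors : Module.IsTorsion o D) {d : D} (hd : d ≠ 0) :
    ∃ f : D →ₗ[o] Dualizing o L, f d ≠ 0 := by
  obtain ⟨a, ha⟩ := IsPrincipalIdealRing.principal (LinearMap.ker (LinearMap.toSpanSingleton o D d))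
  have ha0 : a ≠ 0 := by
    rintro rfl
    obtain ⟨⟨b, hb⟩, hbd⟩ := @htors d
    have : b ∈ LinearMap.ker (LinearMap.toSpanSingleton o D d) := hbd
    rw [ha] at this
    exact nonZeroDivisors.ne_zero hb (by simpa using this)
  have haL : algebraMap o L a ≠ 0 := by simpa using ha0
  have haunit : ¬ IsUnit a := by
    intro h
    have h1 : (1 : o) ∈ LinearMap.ker (LinearMap.toSpanSingleton o D d) := by
      rw [ha]
      exact (Ideal.eq_top_iff_one _).1 (Ideal.span_singleton_eq_top.2 h)
    exact hd (by simpa using h1)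
  let i := (LinearMap.ker (LinearMap.toSpanSingleton o D d)).liftQ _ le_rfl
  have hi : Function.Injective i := LinearMap.ker_eq_bot.1
    (Submodule.ker_liftQ_eq_bot _ _ _ le_rfl)
  let g := (LinearMap.ker (LinearMap.toSpanSingleton o D d)).liftQ
    (LinearMap.toSpanSingleton o (Dualizing o L) (Submodule.Quotient.mk (algebraMap o L a)⁻¹)) (by
      intro x hx
      rw [ha] at hx
      obtain ⟨y, rfl⟩ := Submodule.mem_span_singleton.1 hx
      rw [LinearMap.mem_ker, LinearMap.toSpanSingleton_apply, smul_assoc,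
        ← Submodule.Quotient.mk_smul (r := a), Algebra.smul_def, mul_inv_cancel₀ haL,
        dualizing_mk_eq_zero.2 ⟨1, map_one _⟩, smul_zero])
  obtain ⟨f, hf⟩ := baer_dualizing.extension_property i hi g
  refine ⟨f, fun h => ?_⟩
  have h1 := LinearMap.congr_fun hf (Submodule.Quotient.mk 1)
  have h2 : i (Submodule.Quotient.mk 1) = d := by
    change (1 : o) • d = d
    exact one_smul _ _
  rw [LinearMap.comp_apply, h2, h] at h1
  have h3 : g (Submodule.Quotient.mk 1) =
      (1 : o) • Submodule.Quotient.mk (algebraMap o L a)⁻¹ := rfl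
  rw [h3, one_smul, eq_comm, dualizing_mk_eq_zero] at h1
  obtain ⟨b, hb⟩ := h1
  refine haunit (IsUnit.of_mul_eq_one b (FaithfulSMul.algebraMap_injective o L ?_))
  rw [map_mul, hb, mul_inv_cancel₀ haL, map_one]

end Dualizing

variable (p) in
-- Every nonzero prime contains `p`, so there are finitely many, and a Dedekind domain with finitely
-- many primes is principal.
theorem isPrincipalIdealRing_of_finite_padicInt {o : Type*} [CommRing o] [Algebra ℤ_[p] o]
    [Module.Finite ℤ_[p] o] [IsDedekindDomain o] [Module.Free ℤ_[p] o] :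
    IsPrincipalIdealRing o := by
  refine IsPrincipalIdealRing.of_finite_primes ?_
  have h0 : Ideal.span {(p : o)} ≠ 0 := by
    simpa using natCast_ne_zero p o
  refine (((Ideal.finite_factors h0).image fun v => v.asIdeal).union
    (Set.finite_singleton ⊥)).subset fun P hP => ?_
  by_cases hP0 : P = ⊥
  · exact Or.inr hP0
  · refine Or.inl ⟨⟨P, hP, hP0⟩, ?_, rfl⟩
    change P ∣ _
    rw [Ideal.dvd_span_singleton]
    obtain ⟨a, haP, ha⟩ := Submodule.exists_mem_ne_zero_of_ne_bot hP0
    obtain ⟨n, b, hb⟩ := exists_pow_eq_mul p ha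
    exact hP.mem_of_pow_mem n (hb ▸ P.mul_mem_right _ haP)

end Coefficients

/-! ### Duality with the completed group algebra: a dual Nakayama lemma -/

section CompletedGroupAlgebra

variable {p : ℕ} [Fact p.Prime] {o : Type*} [CommRing o] [IsDomain o] [Algebra ℤ_[p] o]
  [Module.Finite ℤ_[p] o] [Module.Free ℤ_[p] o]
variable {L : Type*} [Field L] [Algebra o L] [IsFractionRing o L]
variable {H : Type*} [Group H] [TopologicalSpace H]
variable {D : Type*} [AddCommGroup D] [Module o D]

include p in
variable (p) in
-- The orbit of a nonzero vector spans a finite module killed by a power of `p`, on which `H` acts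
-- through a `p`-group. Counting fixed points modulo `p` yields one besides `0`.
theorem exists_invariant_ne_zero [IsTopologicalGroup H] [CompactSpace H]
    (hp : ∀ (N : OpenNormalSubgroup H) (h : H), ∃ k : ℕ, h ^ p ^ k ∈ N)
    (htors : Module.IsTorsion o D) {σ : Representation o H D} (hσ : IsNormallySmooth σ)
    {E : Submodule o D} (hE : ∀ h, ∀ x ∈ E, σ h x ∈ E) (hE0 : E ≠ ⊥) :
    ∃ x ∈ E, x ≠ 0 ∧ ∀ h, σ h x = x := by
  obtain ⟨x, hxE, hx0⟩ := Submodule.exists_mem_ne_zero_of_ne_bot hE0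
  obtain ⟨N, hN⟩ := hσ x
  have hsm : IsSmooth σ := fun w => by
    obtain ⟨N, hN⟩ := hσ w
    exact ⟨N.toOpenSubgroup, hN⟩
  let X : Submodule o D := Submodule.span o ((fun h => σ h x) '' Set.univ)
  have hXfin : (X : Set D).Finite :=
    finite_of_fg p htors X (Submodule.fg_span (finite_image_of_isCompact hsm isCompact_univ x))
  have hXE : X ≤ E := by
    refine Submodule.span_le.2 ?_
    rintro _ ⟨h, -, rfl⟩
    exact hE h x hxE
  have hXst : ∀ h, ∀ y ∈ X, σ h y ∈ X := by
    intro h y hy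
    have : X ≤ X.comap (σ h) := by
      refine Submodule.span_le.2 ?_
      rintro _ ⟨k, -, rfl⟩
      refine Submodule.subset_span ⟨h * k, trivial, ?_⟩
      simp
    exact this hy
  have hNX : ∀ n ∈ N, ∀ y ∈ X, σ n y = y := by
    intro n hn y hy
    have : X ≤ LinearMap.eqLocus (σ n) LinearMap.id := by
      refine Submodule.span_le.2 ?_
      rintro _ ⟨k, -, rfl⟩
      change σ n (σ k x) = σ k x
      have e : n * k = k * (k⁻¹ * n * k) := by group
      have hmem : k⁻¹ * n * k ∈ N := by
        have := N.isNormal'.conj_mem n hn k⁻¹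
        rwa [inv_inv] at this
      rw [← Module.End.mul_apply, ← map_mul, e, map_mul, Module.End.mul_apply, hN _ hmem]
    exact this hy
  let φ : H →* Equiv.Perm X :=
    { toFun := fun h =>
        { toFun := fun y => ⟨σ h y, hXst h y y.2⟩
          invFun := fun y => ⟨σ h⁻¹ y, hXst h⁻¹ y y.2⟩
          left_inv := fun y => Subtype.ext (by simp)
          right_inv := fun y => Subtype.ext (by simp) }
      map_one' := by
        ext y
        simp
      map_mul' := fun g h => by
        ext y
        simp }
  have hP : IsPGroup p φ.range := by
    rintro ⟨_, h, rfl⟩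
    obtain ⟨k, hk⟩ := hp N h
    refine ⟨k, Subtype.ext ?_⟩
    change φ h ^ p ^ k = 1
    rw [← map_pow]
    ext y
    exact hNX _ hk y y.2
  have : Finite X := hXfin
  have hxX : x ∈ X := Submodule.subset_span ⟨1, trivial, by simp⟩
  have hdvd : p ∣ Nat.card X := by
    obtain ⟨n, hn⟩ := exists_pow_smul_eq_zero p htors x
    have h1 : (p ^ n) • (⟨x, hxX⟩ : X) = 0 := Subtype.ext (by
      change (p ^ n) • x = 0
      rw [← Nat.cast_smul_eq_nsmul o, Nat.cast_pow, hn])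
    obtain ⟨j, -, hj⟩ := (Nat.dvd_prime_pow Fact.out).1 (addOrderOf_dvd_of_nsmul_eq_zero h1)
    have hj0 : j ≠ 0 := by
      rintro rfl
      rw [pow_zero, AddMonoid.addOrderOf_eq_one_iff] at hj
      exact hx0 (congrArg Subtype.val hj)
    exact ((dvd_pow_self p hj0).trans (dvd_of_eq hj.symm)).trans (addOrderOf_dvd_natCard _)
  obtain ⟨y, hy, hy0⟩ := hP.exists_fixed_point_of_prime_dvd_card_of_fixed_point X hdvd (a := 0) (by
    rintro ⟨_, h, rfl⟩
    exact Subtype.ext (map_zero (σ h)))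
  refine ⟨y, hXE y.2, fun h => hy0 (Subtype.ext h.symm), fun h => ?_⟩
  exact congrArg Subtype.val (hy ⟨φ h, h, rfl⟩)

/-- The functions `H → M` that are constant on the cosets of some open normal subgroup. -/
def smoothFunctions (o H M : Type*) [CommRing o] [Group H] [TopologicalSpace H] [AddCommGroup M]
    [Module o M] : Submodule o (H → M) where
  carrier := {φ | ∃ N : OpenNormalSubgroup H, ∀ h, ∀ n ∈ N, φ (h * n) = φ h}
  zero_mem' := ⟨⟨⊤, inferInstanceAs (⊤ : Subgroup H).Normal⟩, fun _ _ _ => rfl⟩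
  add_mem' := by
    rintro φ ψ ⟨N, hN⟩ ⟨N', hN'⟩
    exact ⟨N ⊓ N', fun h n hn => by rw [Pi.add_apply, hN h n hn.1, hN' h n hn.2, Pi.add_apply]⟩
  smul_mem' := by
    rintro a φ ⟨N, hN⟩
    exact ⟨N, fun h n hn => by rw [Pi.smul_apply, hN h n hn, Pi.smul_apply]⟩

open scoped Classical in
/-- The function on `H` with value `m` on the coset `c` and `0` elsewhere. -/
def cosetFunction {M : Type*} [AddCommGroup M] [Module o M] (N : OpenNormalSubgroup H)
    (c : H ⧸ N.toSubgroup) : M →ₗ[o] smoothFunctions o H M where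
  toFun m := ⟨fun h => if (h : H ⧸ N.toSubgroup) = c then m else 0, N, fun h n hn => by
    beta_reduce
    rw [QuotientGroup.mk_mul_of_mem h hn]⟩
  map_add' m m' := by
    ext h
    by_cases hc : (h : H ⧸ N.toSubgroup) = c <;> simp [hc]
  map_smul' a m := by
    ext h
    by_cases hc : (h : H ⧸ N.toSubgroup) = c <;> simp [hc]

open scoped Classical in
theorem cosetFunction_apply {M : Type*} [AddCommGroup M] [Module o M] (N : OpenNormalSubgroup H)
    (c : H ⧸ N.toSubgroup) (m : M) (h : H) :
    (cosetFunction (o := o) N c m).1 h = if (h : H ⧸ N.toSubgroup) = c then m else 0 := rfl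

include p in
variable (p) in
-- On functions supported on one coset, `l` is an endomorphism of `L/o`, hence a scalar. These
-- scalars are compatible because a coset function of `N'` is the sum of those of the cosets of `N`
-- inside it.
theorem exists_iwasawa_of_functional [∀ N : OpenNormalSubgroup H, Finite (H ⧸ N.toSubgroup)]
    (l : smoothFunctions o H (Dualizing o L) →ₗ[o] Dualizing o L) :
    ∃ a : iwasawaAlgebra o H, ∀ (N : OpenNormalSubgroup H) (c : H ⧸ N.toSubgroup)
      (m : Dualizing o L), l (cosetFunction N c m) = (a.1 N).coeff c • m := by
  classical
  choose a ha using fun (N : OpenNormalSubgroup H) (c : H ⧸ N.toSubgroup) =>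
    exists_end_eq_smul p (l ∘ₗ cosetFunction N c)
  have := fun N : OpenNormalSubgroup H => Fintype.ofFinite (H ⧸ N.toSubgroup)
  let A : ∀ N : OpenNormalSubgroup H, MonoidAlgebra o (H ⧸ N.toSubgroup) :=
    fun N => ∑ c, MonoidAlgebra.single c (a N c)
  have hA : ∀ (N : OpenNormalSubgroup H) (c : H ⧸ N.toSubgroup), (A N).coeff c = a N c := by
    intro N c
    have e : (A N).coeff = ∑ c, Finsupp.single c (a N c) :=
      map_sum MonoidAlgebra.coeffAddEquiv _ _
    rw [e, Finsupp.finsetSum_apply]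
    simp [Finsupp.single_apply]
  refine ⟨⟨A, fun N N' hNN' => ?_⟩, fun N c m => ?_⟩
  · have key : ∀ c', a N' c' = ∑ c with
        QuotientGroup.map N.toSubgroup N'.toSubgroup (MonoidHom.id H) hNN' c = c', a N c := by
      intro c'
      refine sub_eq_zero.1 (eq_zero_of_smul_dualizing (L := L) p fun m => ?_)
      rw [sub_smul, ← ha, Finset.sum_smul, Finset.sum_congr rfl fun c _ => (ha N c m).symm,
        sub_eq_zero]
      simp only [LinearMap.comp_apply]
      rw [← map_sum]
      congr 1
      refine Subtype.ext (funext fun h => ?_)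
      rw [AddSubmonoidClass.coe_finsetSum, Finset.sum_apply]
      simp only [cosetFunction_apply]
      rw [Finset.sum_ite_eq]
      simp only [Finset.mem_filter, Finset.mem_univ, true_and]
      rfl
    change MonoidAlgebra.mapDomainAlgHom o o _ (∑ c, MonoidAlgebra.single c (a N c)) =
      ∑ c, MonoidAlgebra.single c (a N' c)
    rw [map_sum, ← Finset.sum_fiberwise Finset.univ
      (QuotientGroup.map N.toSubgroup N'.toSubgroup (MonoidHom.id H) hNN')]
    refine Finset.sum_congr rfl fun c' _ => ?_
    rw [key, ← MonoidAlgebra.singleAddHom_apply, map_sum]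
    refine Finset.sum_congr rfl fun c hc => ?_
    rw [Finset.mem_filter] at hc
    rw [← hc.2]
    simp [MonoidAlgebra.mapDomainAlgHom]
  · rw [hA, ← ha]
    rfl

include p in
variable (p) in
-- For each invariant `d ≠ 0` choose a functional `f d` not vanishing at `d`; these finitely many
-- functionals generate. Their matrix coefficients embed `D` in a finite power of the smooth
-- functions, and a functional on `D` extends to that power, where it is given by elements of
-- `o[[H]]`.
theorem finite_smoothDual [IsPrincipalIdealRing o] [IsTopologicalGroup H] [CompactSpace H]
    (hp : ∀ (N : OpenNormalSubgroup H) (h : H), ∃ k : ℕ, h ^ p ^ k ∈ N)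
    (htors : Module.IsTorsion o D) {σ : Representation o H D} (hσ : IsNormallySmooth σ)
    (hfin : {x | ∀ h, σ h x = x}.Finite) :
    Module.Finite (iwasawaAlgebra o H) (SmoothDual (Dualizing o L) σ hσ) := by
  classical
  have hquot : ∀ N : OpenNormalSubgroup H, Finite (H ⧸ N.toSubgroup) := fun N =>
    Subgroup.quotient_finite_of_isOpen _ N.isOpen'
  have := fun N : OpenNormalSubgroup H => Fintype.ofFinite (H ⧸ N.toSubgroup)
  let ι : Type _ := {x | ∀ h, σ h x = x}
  have : Finite ι := hfin
  have := Fintype.ofFinite ι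
  have hex : ∀ d : ι, ∃ f : D →ₗ[o] Dualizing o L, d.1 ≠ 0 → f d.1 ≠ 0 := by
    intro d
    by_cases hd : d.1 = 0
    · exact ⟨0, fun h => absurd hd h⟩
    · obtain ⟨f, hf⟩ := exists_dual_ne_zero (L := L) htors hd
      exact ⟨f, fun _ => hf⟩
  choose f hf using hex
  have hsmooth : ∀ (N : OpenNormalSubgroup H) (x : D), (∀ n ∈ N, σ n x = x) →
      ∀ h, ∀ n ∈ N, σ (h * n)⁻¹ x = σ h⁻¹ x := by
    intro N x hx h n hn
    have e : (h * n)⁻¹ = h⁻¹ * (h * n⁻¹ * h⁻¹) := by group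
    rw [e, map_mul, Module.End.mul_apply, hx _ (N.isNormal'.conj_mem _ (inv_mem hn) h)]
  let Φ : D →ₗ[o] (ι → smoothFunctions o H (Dualizing o L)) :=
    LinearMap.pi fun i =>
      { toFun := fun x => ⟨fun h => f i (σ h⁻¹ x), by
          obtain ⟨N, hN⟩ := hσ x
          exact ⟨N, fun h n hn => congrArg (f i) (hsmooth N x hN h n hn)⟩⟩
        map_add' := fun x y => by
          ext h
          simp
        map_smul' := fun a x => by
          ext h
          simp }
  -- The kernel is `H`-stable, so if nonzero it contains an invariant `x ≠ 0`; but `f x` does not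
  -- vanish at `x`.
  have hΦ : Function.Injective Φ := by
    rw [← LinearMap.ker_eq_bot]
    by_contra hne
    obtain ⟨x, hx, hx0, hinv⟩ := exists_invariant_ne_zero p hp htors hσ
      (E := LinearMap.ker Φ) (fun k x hx => by
        refine funext fun i => Subtype.ext (funext fun h => ?_)
        have h1 := congrFun (congrArg Subtype.val (congrFun hx i)) (k⁻¹ * h)
        change f i (σ (k⁻¹ * h)⁻¹ x) = 0 at h1
        change f i (σ h⁻¹ (σ k x)) = 0
        rw [← Module.End.mul_apply, ← map_mul, ← h1, mul_inv_rev, inv_inv]) hne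
    refine hf ⟨x, hinv⟩ hx0 ?_
    have h1 := congrFun (congrArg Subtype.val (congrFun hx ⟨x, hinv⟩)) 1
    change f ⟨x, hinv⟩ (σ 1⁻¹ x) = 0 at h1
    rwa [hinv] at h1
  refine ⟨?_⟩
  let f' : ι → SmoothDual (Dualizing o L) σ hσ := f
  have htop : Submodule.span (iwasawaAlgebra o H)
      (Set.range f') = ⊤ := by
    rw [eq_top_iff]
    intro g _
    obtain ⟨l, hl⟩ := baer_dualizing.extension_property Φ hΦ (g : D →ₗ[o] Dualizing o L)
    choose a ha using fun i => exists_iwasawa_of_functional p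
      (l ∘ₗ LinearMap.single o (fun _ : ι => smoothFunctions o H (Dualizing o L)) i)
    suffices hg : g = ∑ i, a i • f' i by
      rw [hg]
      exact Submodule.sum_mem _ fun i _ => Submodule.smul_mem _ _
        (Submodule.subset_span ⟨i, rfl⟩)
    refine LinearMap.ext fun w => ?_
    obtain ⟨N, hN⟩ := hσ w
    let ev : SmoothDual (Dualizing o L) σ hσ →+ Dualizing o L :=
      { toFun := fun f => (show D →ₗ[o] Dualizing o L from f) w
        map_zero' := rfl
        map_add' := fun _ _ => rfl }
    have e1 : ev (∑ i, a i • f' i) = ∑ i, SmoothDual.act hσ (a i) (f i) w :=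
      map_sum ev _ _
    change ev g = ev (∑ i, a i • f' i)
    have e2 : ∀ i, SmoothDual.act hσ (a i) (f i) w =
        ∑ c : H ⧸ N.toSubgroup, ((a i).1 N).coeff c • f i (σ (Quotient.out c)⁻¹ w) := by
      intro i
      rw [SmoothDual.act_apply (a i) (f i) w N hN]
      exact Finsupp.sum_fintype _ _ fun c => zero_smul _ _
    -- As `N` fixes `w`, the components of `Φ w` are constant on the cosets of `N`, hence finite
    -- sums of coset functions, on which `l` is known.
    have e3 : Φ w = ∑ i, LinearMap.single o
        (fun _ : ι => smoothFunctions o H (Dualizing o L)) i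
        (∑ c : H ⧸ N.toSubgroup, cosetFunction N c (f i (σ (Quotient.out c)⁻¹ w))) := by
      simp only [LinearMap.single_apply]
      rw [Finset.univ_sum_single]
      refine funext fun i => Subtype.ext (funext fun h => ?_)
      rw [AddSubmonoidClass.coe_finsetSum, Finset.sum_apply]
      simp only [cosetFunction_apply]
      rw [Finset.sum_ite_eq, if_pos (Finset.mem_univ _)]
      obtain ⟨n, hn⟩ := QuotientGroup.mk_out_eq_mul N.toSubgroup h
      change f i (σ h⁻¹ w) = f i (σ ((h : H ⧸ N.toSubgroup).out)⁻¹ w)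
      rw [hn, hsmooth N w hN h n n.2]
    have e4 : ev g = l (Φ w) := (LinearMap.congr_fun hl w).symm
    rw [e1, e4, e3, map_sum]
    refine Finset.sum_congr rfl fun i _ => ?_
    rw [e2, map_sum, map_sum]
    exact Finset.sum_congr rfl fun c _ => ha i N c _
  exact htop ▸ Submodule.fg_span (Set.finite_range _)

end CompletedGroupAlgebra

/-! ### `U₀` is pro-`p`, and topologically finitely generated in characteristic 0 -/

section Unipotent

variable {F : Type*} [Field F] [ValuativeRel F] [TopologicalSpace F] [IsNonarchimedeanLocalField F]
variable (p : ℕ) [CharP (IsLocalRing.ResidueField (IntegerRing F)) p]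
variable (ϖ : IntegerRing F) (hϖ : Irreducible ϖ)

theorem compactSpace_unipotentInt : CompactSpace (unipotentInt F) := by
  have := t2Space (F := F)
  refine isCompact_iff_compactSpace.1 (isCompact_maxCompact.of_isClosed_subset ?_ fun _ h => h.2)
  have h : IsClosed (unipotent F : Set (GL (Fin 2) F)) :=
    (isClosed_eq (continuous_entry 1 0) continuous_const).inter
      ((isClosed_eq (continuous_entry 0 0) continuous_const).inter
        (isClosed_eq (continuous_entry 1 1) continuous_const))
  exact h.inter (Subgroup.isClosed_of_isOpen _ isOpen_maxCompact)

include hϖ in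
theorem exists_unipotentElt_mem {A : Set (GL (Fin 2) F)} (hA : A ∈ 𝓝 1) : ∃ n : ℕ,
    ∀ y : F, valuation F y ≤ valuation F (ϖ : F) ^ n → unipotentElt y ∈ A := by
  obtain ⟨n, -, h⟩ := exists_principal_subset ϖ hϖ hA
  refine ⟨n, fun y hy => h _ (unipotentElt_mem_iff.2
    (hy.trans (pow_le_one₀ zero_le ϖ.2))).2 fun i j => ?_⟩
  fin_cases i <;> fin_cases j <;> simp [coe_unipotentElt, hy]

theorem unipotentElt_nsmul (m : ℕ) (y : F) : unipotentElt (m * y) = unipotentElt y ^ m := by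
  induction m with
  | zero => simp [unipotentElt_zero]
  | succ m ih =>
    rw [pow_succ, ← ih, ← unipotentElt_add]
    congr 1
    push_cast
    ring

include hϖ in
theorem valuation_natCast_le : valuation F (p : F) ≤ valuation F (ϖ : F) := by
  have h1 : (p : IntegerRing F) ∈ IsLocalRing.maximalIdeal (IntegerRing F) := by
    rw [← IsLocalRing.residue_eq_zero_iff, map_natCast]
    exact CharP.cast_eq_zero _ p
  rw [hϖ.maximalIdeal_eq, Ideal.mem_span_singleton] at h1
  obtain ⟨c, hc⟩ := h1
  have h2 : (p : F) = (ϖ : F) * (c : F) := by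
    rw [← Subring.coe_mul, ← hc]
    simp
  rw [h2, map_mul]
  exact mul_le_of_le_one_right zero_le c.2

include hϖ in
theorem valuation_pow_natCast_mul_le (k : ℕ) {y : F} (hy : valuation F y ≤ 1) :
    valuation F ((p : F) ^ k * y) ≤ valuation F (ϖ : F) ^ k := by
  rw [map_mul, map_pow]
  exact mul_le_of_le_of_le_one (pow_le_pow_left₀ zero_le (valuation_natCast_le p ϖ hϖ) k) hy

include hϖ in
-- Raising to the power `p ^ n` multiplies the upper right entry by `p ^ n`, which tends to zero.
theorem exists_pow_mem_openNormalSubgroup (N : OpenNormalSubgroup (unipotentInt F))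
    (h : unipotentInt F) : ∃ k : ℕ, h ^ p ^ k ∈ N := by
  have hN : (N : Set (unipotentInt F)) ∈ 𝓝 (1 : unipotentInt F) := N.toOpenSubgroup.mem_nhds_one
  rw [nhds_subtype_eq_comap, Filter.mem_comap] at hN
  obtain ⟨A, hA, hAN⟩ := hN
  obtain ⟨n, hn⟩ := exists_unipotentElt_mem ϖ hϖ hA
  refine ⟨n, hAN ?_⟩
  have h1 := eq_unipotentElt h.2
  have h2 : valuation F (h.1.1 0 1) ≤ 1 := unipotentElt_mem_iff.1 (h1 ▸ h.2)
  change ((h ^ p ^ n : unipotentInt F) : GL (Fin 2) F) ∈ A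
  rw [Subgroup.coe_pow, h1, ← unipotentElt_nsmul]
  push_cast
  exact hn _ (valuation_pow_natCast_mul_le p ϖ hϖ n h2)

variable {o V : Type*} [CommRing o] [AddCommGroup V] [Module o V]

include p hϖ in
-- `T` represents `O_F` modulo `p`, a finite quotient because `p ≠ 0` in characteristic 0.
-- Successive division by `p` moves any upper right entry into `p ^ k O_F` without changing the
-- effect on `v`, and smoothness concludes.
theorem exists_finset_generators [CharZero F] (hp : p ≠ 0) : ∃ T : Finset F,
    (∀ τ ∈ T, valuation F τ ≤ 1) ∧ ∀ {ρ : Representation o (GL (Fin 2) F) V}, IsSmooth ρ →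
      ∀ v : V, (∀ τ ∈ T, ρ (unipotentElt τ) v = v) → ∀ u ∈ unipotentInt F, ρ u v = v := by
  have hp0 : (p : F) ≠ 0 := by exact_mod_cast hp
  have hvp : valuation F (p : F) ≠ 0 := (Valuation.ne_zero_iff _).2 hp0
  obtain ⟨T, hT, hcov⟩ := (IsNonarchimedeanLocalField.isCompact_closedBall F 1).elim_nhds_subcover
    (fun a => {x | valuation F (x - a) ≤ valuation F (p : F)}) fun a _ =>
      (isOpen_setOf_valuation_le (continuous_id.sub continuous_const) hvp).mem_nhds
        (by simp)
  refine ⟨T, hT, fun {ρ} hρ v hv u hu => ?_⟩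
  have hpow : ∀ τ ∈ T, ∀ m : ℕ, ρ (unipotentElt ((m : F) * τ)) v = v := by
    intro τ hτ m
    induction m with
    | zero => simp [unipotentElt_zero]
    | succ m ih =>
      have e : ((m + 1 : ℕ) : F) * τ = m * τ + τ := by
        push_cast
        ring
      rw [e, unipotentElt_add, map_mul, Module.End.mul_apply, hv τ hτ, ih]
  have hstep : ∀ k : ℕ, ∀ x : F, valuation F x ≤ 1 → ∃ y : F, valuation F y ≤ 1 ∧
      ρ (unipotentElt x) v = ρ (unipotentElt ((p : F) ^ k * y)) v := by
    intro k x hx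
    induction k with
    | zero => exact ⟨x, hx, by simp⟩
    | succ k ih =>
      obtain ⟨y, hy, e⟩ := ih
      obtain ⟨τ, hτ, h⟩ := Set.mem_iUnion₂.1 (hcov hy)
      refine ⟨(y - τ) / p, ?_, ?_⟩
      · rw [map_div₀]
        exact div_le_one_of_le₀ h zero_le
      · have e2 : (p : F) ^ k * y =
            (p : F) ^ (k + 1) * ((y - τ) / p) + ((p ^ k : ℕ) : F) * τ := by
          push_cast
          field_simp
          ring
        rw [e, e2, unipotentElt_add, map_mul, Module.End.mul_apply, hpow τ hτ]
  obtain ⟨H, hH⟩ := hρ v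
  obtain ⟨n, hn⟩ := exists_unipotentElt_mem ϖ hϖ H.mem_nhds_one
  have h1 := eq_unipotentElt hu
  obtain ⟨y, hy, e⟩ := hstep n (u.1 0 1) (unipotentElt_mem_iff.1 (h1 ▸ hu))
  rw [h1, e]
  exact hH _ (hn _ (valuation_pow_natCast_mul_le p ϖ hϖ n hy))

include p hϖ in
-- The differences `τ m - m`, for `τ` in a finite set of topological generators, take finitely many
-- values in `Δ`. Two vectors with the same differences differ by a `U₀`-invariant of `M`.
theorem finite_invariants_quotient [CharZero F] (hp : p ≠ 0)
    {ρ : Representation o (GL (Fin 2) F) V} (hρ : IsSmooth ρ) {M Δ : Submodule o V}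
    (hΔ : (Δ : Set V).Finite)
    (hM : {m : V | m ∈ M ∧ ∀ u ∈ unipotentInt F, ρ u m = m}.Finite) :
    {m : V | m ∈ M ∧ ∀ u ∈ unipotentInt F, ρ u m - m ∈ Δ}.Finite := by
  obtain ⟨T, hT, hgen⟩ := exists_finset_generators (o := o) (V := V) p ϖ hϖ hp
  let f : V → T → V := fun m τ => ρ (unipotentElt τ.1) m - m
  have hS : (Set.univ.pi fun _ : T => (Δ : Set V)).Finite := Set.Finite.pi fun _ => hΔ
  let A : Set V := {m | m ∈ M ∧ ∀ u ∈ unipotentInt F, ρ u m - m ∈ Δ}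
  refine (hS.biUnion (t := fun b => {m | m ∈ A ∧ f m = b}) fun b _ => ?_).subset fun m hm => ?_
  · rcases Set.eq_empty_or_nonempty {m | m ∈ A ∧ f m = b} with h | ⟨m₀, hm₀, hb₀⟩
    · rw [h]
      exact Set.finite_empty
    · refine (hM.image (· + m₀)).subset fun m hm => ⟨m - m₀, ⟨sub_mem hm.1.1 hm₀.1, ?_⟩,
        sub_add_cancel _ _⟩
      refine hgen hρ _ fun τ hτ => ?_
      have h1 : f m ⟨τ, hτ⟩ = f m₀ ⟨τ, hτ⟩ := by rw [hm.2, hb₀]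
      change ρ (unipotentElt τ) m - m = ρ (unipotentElt τ) m₀ - m₀ at h1
      rw [map_sub, sub_eq_sub_iff_sub_eq_sub]
      exact h1
  · refine Set.mem_biUnion (x := f m) (fun τ _ => ?_) ⟨hm, rfl⟩
    exact hm.2 _ (unipotentElt_mem_iff.2 (hT _ τ.2))

end Unipotent

/-! ### Invariants of `D_V(V₀)` and the main theorem -/

section Main

variable {F : Type*} [Field F] [ValuativeRel F] [TopologicalSpace F] [IsNonarchimedeanLocalField F]
variable {o V : Type*} [CommRing o] [AddCommGroup V] [Module o V]
variable {ρ : Representation o (GL (Fin 2) F) V} (ϖ : IntegerRing F) (hϖ : Irreducible ϖ)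

theorem isTorsion_DV (htors : Module.IsTorsion o V) (V₀ : Submodule o V) :
    Module.IsTorsion o (DV ρ ϖ hϖ V₀) := by
  intro x
  obtain ⟨m, rfl⟩ := Submodule.Quotient.mk_surjective _ x
  obtain ⟨a, ha⟩ := @htors m
  refine ⟨a, ?_⟩
  have h : (a : o) • m = 0 := Subtype.ext ha
  exact congrArg ((deltaPart ρ ϖ hϖ V₀).submoduleOf (plusPart ρ ϖ hϖ V₀)).mkQ h

theorem finite_invariants_DVRep (p : ℕ) (hp : p ≠ 0)
    [CharP (IsLocalRing.ResidueField (IntegerRing F)) p] [CharZero F] (hρ : IsSmooth ρ)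
    {V₀ : Submodule o V} (hΔ : (deltaPart ρ ϖ hϖ V₀ : Set V).Finite)
    (hM : {m : V | m ∈ plusPart ρ ϖ hϖ V₀ ∧ ∀ u ∈ unipotentInt F, ρ u m = m}.Finite) :
    {x | ∀ u, DVRep ρ ϖ hϖ V₀ u x = x}.Finite := by
  have h := finite_invariants_quotient p ϖ hϖ hp hρ hΔ hM
  refine ((h.preimage (f := ((↑) : plusPart ρ ϖ hϖ V₀ → V))
    Subtype.val_injective.injOn).image Submodule.Quotient.mk).subset fun x hx => ?_
  obtain ⟨m, rfl⟩ := Submodule.Quotient.mk_surjective _ x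
  refine ⟨m, ⟨m.2, fun u hu => ?_⟩, rfl⟩
  have h1 : (Submodule.Quotient.mk (subRep ρ (unipotentInt F) (plusPart ρ ϖ hϖ V₀)
      (plusPart_stable ρ ϖ hϖ V₀) ⟨u, hu⟩ m) : DV ρ ϖ hϖ V₀) = Submodule.Quotient.mk m :=
    hx ⟨u, hu⟩
  exact ((Submodule.Quotient.eq _).1 h1 :)

theorem borelInt_sup_centre_le : borelInt F ⊔ centre F ≤ maxCompact F ⊔ centre F :=
  sup_le_sup_right inf_le_right _

end Main

end GL2Rep

end

theorem mainTheorem6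
    (p : ℕ) [Fact p.Prime]
    (F : Type*) [Field F] [ValuativeRel F] [TopologicalSpace F] [IsNonarchimedeanLocalField F]
    [CharP (IsLocalRing.ResidueField (GL2Rep.IntegerRing F)) p]
    (ϖ : GL2Rep.IntegerRing F) (hϖ : Irreducible ϖ)
    (L : Type*) [Field L] [Algebra ℚ_[p] L] [FiniteDimensional ℚ_[p] L]
    [Algebra ℤ_[p] L] [IsScalarTower ℤ_[p] ℚ_[p] L]
    (V : Type*) [AddCommGroup V] [Module (integralClosure ℤ_[p] L) V]
    (ρ : Representation (integralClosure ℤ_[p] L) (GL (Fin 2) F) V)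
    (hsmooth : GL2Rep.IsSmooth ρ)
    (htors : Module.IsTorsion (integralClosure ℤ_[p] L) V)
    (hadm : GL2Rep.IsAdmissible ρ)
    (hpres : GL2Rep.IsFinitelyPresented ρ (GL2Rep.maxCompact F ⊔ GL2Rep.centre F)) :
    (∀ M : Submodule (integralClosure ℤ_[p] L) V,
      GL2Rep.IsFGUnder ρ (GL2Rep.borelPlus ϖ hϖ) M →
        {m : V | m ∈ M ∧ ∀ u ∈ GL2Rep.unipotentInt F, ρ u m = m}.Finite) ∧
    (CharZero F →
      ∀ V₀ : Submodule (integralClosure ℤ_[p] L) V,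
        GL2Rep.IsFGUnder ρ (GL2Rep.borelInt F ⊔ GL2Rep.centre F : Subgroup (GL (Fin 2) F)) V₀ →
        GL2Rep.orbitSpan ρ (GL2Rep.borel F) V₀ = ⊤ →
          Module.Finite
            (GL2Rep.iwasawaAlgebra (integralClosure ℤ_[p] L) (GL2Rep.unipotentInt F))
            (GL2Rep.DVDual ρ ϖ hϖ V₀
              (L ⧸ LinearMap.range (Algebra.linearMap (integralClosure ℤ_[p] L) L))
              hsmooth)) := by
  have : Module.Finite ℤ_[p] (integralClosure ℤ_[p] L) :=
    IsIntegralClosure.finite ℤ_[p] ℚ_[p] L _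
  have : IsFractionRing (integralClosure ℤ_[p] L) L :=
    integralClosure.isFractionRing_of_finite_extension ℚ_[p] L
  have : IsDedekindDomain (integralClosure ℤ_[p] L) :=
    integralClosure.isDedekindDomain ℤ_[p] ℚ_[p] L
  have hinj : Function.Injective (algebraMap ℤ_[p] (integralClosure ℤ_[p] L)) := by
    refine Function.Injective.of_comp (f := algebraMap (integralClosure ℤ_[p] L) L) ?_
    rw [← RingHom.coe_comp, ← IsScalarTower.algebraMap_eq,
      IsScalarTower.algebraMap_eq ℤ_[p] ℚ_[p] L, RingHom.coe_comp]
    exact (algebraMap ℚ_[p] L).injective.comp (IsFractionRing.injective ℤ_[p] ℚ_[p])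
  have : Module.IsTorsionFree ℤ_[p] (integralClosure ℤ_[p] L) :=
    Module.isTorsionFree_iff_algebraMap_injective.2 hinj
  have : Module.Free ℤ_[p] (integralClosure ℤ_[p] L) := Module.free_of_finite_type_torsion_free'
  have := GL2Rep.isPrincipalIdealRing_of_finite_padicInt p (o := integralClosure ℤ_[p] L)
  have hFG := GL2Rep.finite_of_fg p htors
  have hpart := fun (X : Set V) (hX : X.Finite) =>
    GL2Rep.finite_unipotentInt_invariants hsmooth hadm hFG hpres ϖ hϖ hX
  refine ⟨?_, fun hchar V₀ hV₀ hgen => ?_⟩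
  · rintro M ⟨-, X, -, rfl⟩
    exact hpart X X.finite_toSet
  -- `V₀` is finite as a set, so the bounds for a finite generating set apply with `V₀` itself in
  -- that role.
  · have hV₀fin := GL2Rep.finite_of_isFGUnder hsmooth hadm hFG GL2Rep.borelInt_sup_centre_le hV₀
    have hΔ := GL2Rep.finite_borelPlus_inf_diff hsmooth hadm hFG hpres ϖ hϖ hV₀fin
    have := GL2Rep.compactSpace_unipotentInt (F := F)
    exact GL2Rep.finite_smoothDual p (GL2Rep.exists_pow_mem_openNormalSubgroup p ϖ hϖ)
      (GL2Rep.isTorsion_DV ϖ hϖ htors V₀) (GL2Rep.DVRep_smooth ρ ϖ hϖ V₀ hsmooth)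
      (GL2Rep.finite_invariants_DVRep ϖ hϖ p (Fact.out : p.Prime).ne_zero hsmooth hΔ
        (hpart V₀ hV₀fin))
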